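/- Let $d\ge 1$, and let $E$ be the set of edges $\langle x,y\rangle$ of $\mathbb{Z}^d$ ($x\sim y$ iff $|x-y|=1$). Let $w:\mathbb{Z}^d\to(0,1]$ satisfy $\sum_x w(x)<\infty$ and, for some $w_0>0$, $w(x)\le w_0w(y)$ for all $x\sim y$. Let $q>1$ and $p=2q/(q-1)$, and put $$\mathcal{S}_p=\Big\{\sigma\in\mathbb{R}^{\mathbb{Z}^d}:\sum_x|\sigma(x)|^pw(x)<\infty\Big\},\qquad \mathcal{J}_q=\Big\{J\in\mathbb{R}^{E}:\|J\|_q^q=\sum_{\langle x,y\rangle\in E}|J_{xy}|^q\,[w(x)+w(y)]<\infty\Big\},$$ the latter with its norm topology. Let $\chi_x$, $x\in\mathbb{Z}^d$, be probability measures on $\mathbb{R}$ such that for every $\lambda>0$ $$\sup_x\int e^{\lambda|u|^{p}}\chi_x(du)<\infty,\qquad \inf_x\int e^{-\lambda|u|^{p}}\chi_x(du)>0 .$$ For nonempty finite $\Delta\subset\mathbb{Z}^d$, $J\in\mathcal{J}_q$ and $\xi\in\mathbb{R}^{\mathbb{Z}^d}$, let $$-H_\Delta(\sigma_\Delta|J,\xi)=\sum_{\langle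 x,y\rangle\in E,\ x,y\in\Delta}J_{xy}\sigma(x)\sigma(y)+\sum_{x\in\Delta,\ y\in\Delta^c,\ x\sim y}J_{xy}\sigma(x)\xi(y),$$ $$Z_\Delta(J,\xi)=\int e^{-H_\Delta(\sigma_\Delta|J,\xi)}\prod_{x\in\Delta}\chi_x(d\sigma(x)),\qquad p_\Delta(J,\xi)=\frac1{|\Delta|}\log Z_\Delta(J,\xi),$$ and let $\pi_\Delta(\cdot|J,\xi)$ be the law of $\sigma_\Delta\times\xi_{\Delta^c}$ (equal to $\sigma_\Delta$ on $\Delta$ and to $\xi$ off $\Delta$) when $\sigma_\Delta$ has law $Z_\Delta(J,\xi)^{-1}e^{-H_\Delta(\sigma_\Delta|J,\xi)}\prod_{x\in\Delta}\chi_x(d\sigma(x))$. Let $\mathcal{G}_p(J)$ be the set of Borel probability measures $\mu$ on $\mathbb{R}^{\mathbb{Z}^d}$ (product topology) with $\mu(\mathcal{S}_p)=1$ and $\int\pi_\Delta(A|J,\xi)\,\mu(d\xi)=\mu(A)$ for all Borel $A$ and all nonempty finite $\Delta$. Let $\nu$ be a probability measure on $\mathcal{J}_q$, defined on a $\sigma$-field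 that contains the Borel sets (for example the Borel $\sigma$-field or its $\nu$-completion). A random Gibbs measure is a measurable map $J\mapsto\mu(J)$ from $\mathcal{J}_q$ to the Borel probability measures on $\mathbb{R}^{\mathbb{Z}^d}$ (with the Borel $\sigma$-field of the weak topology) such that $\mu(J)\in\mathcal{G}_p(J)$ for $\nu$-almost all $J$; put $\vartheta(d\sigma,dJ)=\mu(J)(d\sigma)\,\nu(dJ)$. A sequence $\mathcal{D}=\{\Delta_n\}_{n\ge1}$ of nonempty finite subsets of $\mathbb{Z}^d$ is cofinal if it is strictly increasing with respect to inclusion and its union is $\mathbb{Z}^d$; put $$p_{\mathcal{D},N}(J,\xi)=\frac1N\sum_{n=1}^Np_{\Delta_n}(J,\xi),\qquad \bar p^\mu_{\mathcal{D},N}(J)=\int p_{\mathcal{D},N}(J,\xi)\,\mu(J)(d\xi).$$ **Theorem.** Suppose that $\sup_{\langle x,y\rangle\in E}\int_{\mathcal{J}_q}|J_{xy}|^q\,\nu(dJ)<\infty$, and let $\mu$ be any random Gibbs measure. Then for $\nu$-almost all $J$ every $p_\Delta(J,\cdot)$ is $\mu(J)$-integrable, so that $\bar p^\mu_{\mathcal{D},N}(J)$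 is well defined, and: 1. there exist a cofinal sequence $\mathcal{D}$ and $p^\mu\in L^1(\mathcal{J}_q,\nu)$ such that $\bar p^\mu_{\mathcal{D},N}(J)\to p^\mu(J)$ as $N\to\infty$ for $\nu$-almost all $J$; 2. there exist a cofinal sequence $\mathcal{D}$ and $\mathsf{p}\in L^1(\mathbb{R}^{\mathbb{Z}^d}\times\mathcal{J}_q,\vartheta)$ such that $p_{\mathcal{D},N}(J,\xi)\to \mathsf{p}(\xi,J)$ as $N\to\infty$ for $\vartheta$-almost all $(\xi,J)$. -/

import Mathlib

open MeasureTheory Filter Topology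
open scoped ENNReal

noncomputable section

namespace RandomSpin

/-! ### The lattice -/

/-- Sites of the lattice `ℤ^d`. -/
abbrev Site (d : ℕ) : Type := Fin d → ℤ

/-- Configurations of real spins: `ℝ^{ℤ^d}`, with the product topology and `σ`-field. -/
abbrev Config (d : ℕ) : Type := Site d → ℝ

/-- The nearest-neighbour graph on `ℤ^d`: `x ∼ y` iff `|x - y| = 1`. -/
def lattice (d : ℕ) : SimpleGraph (Site d) where
  Adj x y := ∑ i, |x i - y i| = 1
  symm := ⟨fun x y h => by simpa only [abs_sub_comm] using h⟩
  loopless := ⟨fun x h => by simp at h⟩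

/-- The set `E` of (unordered) edges of the lattice. -/
abbrev Edge (d : ℕ) : Type := (lattice d).edgeSet

/-- The finite set of neighbours of a site. -/
def nbrs {d : ℕ} (x : Site d) : Finset (Site d) :=
  open scoped Classical in
  (Finset.Icc (fun i => x i - 1) (fun i => x i + 1)).filter (fun y => (lattice d).Adj x y)

theorem mem_nbrs {d : ℕ} (x y : Site d) : y ∈ nbrs x ↔ (lattice d).Adj x y := by
  classical
  simp only [nbrs, Finset.mem_filter, Finset.mem_Icc, and_iff_right_iff_imp]
  intro h
  have hi : ∀ i, |x i - y i| ≤ 1 := fun i => by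
    have h' : ∑ i, |x i - y i| = 1 := h
    rw [← h']
    exact Finset.single_le_sum (f := fun i => |x i - y i|) (fun j _ => abs_nonneg _)
      (Finset.mem_univ i)
  constructor <;> intro i <;> have := abs_le.1 (hi i) <;> dsimp only <;> omega

/-- The edges with both endpoints in `Δ`. -/
def edgesIn {d : ℕ} (Δ : Finset (Site d)) : Finset (Edge d) :=
  open scoped Classical in
  Δ.sym2.subtype (fun e => e ∈ (lattice d).edgeSet)

/-- Cofinal sequences: increasing (strictly, so that no volume is listed twice), exhausting
sequences of nonempty finite subsets of `ℤ^d`. -/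
structure IsCofinal {d : ℕ} (D : ℕ → Finset (Site d)) : Prop where
  nonempty : ∀ n, (D n).Nonempty
  strictMono : StrictMono D
  exhausting : ∀ x, ∃ n, x ∈ D n

/-! ### Weights and the spaces of tempered intensities and tempered spins -/

/-- Weights `w : ℤ^d → (0, 1]`, summable and with `w x ≤ w₀ * w y` for neighbours. -/
structure Weight (d : ℕ) where
  toFun : Site d → ℝ
  pos : ∀ x, 0 < toFun x
  le_one : ∀ x, toFun x ≤ 1
  summable : Summable toFun
  nbr_bound : ∃ w₀ : ℝ, 0 < w₀ ∧ ∀ x y, (lattice d).Adj x y → toFun x ≤ w₀ * toFun y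

instance (d : ℕ) : CoeFun (Weight d) (fun _ => Site d → ℝ) := ⟨Weight.toFun⟩

/-- The weight `w x + w y` of the edge `⟨x, y⟩`. -/
def Weight.edge {d : ℕ} (w : Weight d) (e : Edge d) : ℝ :=
  Sym2.lift ⟨fun x y => w x + w y, fun x y => add_comm (w x) (w y)⟩ e.1

theorem Weight.edge_pos {d : ℕ} (w : Weight d) (e : Edge d) : 0 < w.edge e := by
  obtain ⟨⟨x, y⟩, he⟩ := e
  exact add_pos (w.pos x) (w.pos y)

section Intensity

variable {d : ℕ} (q : ℝ) (w : Weight d)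

theorem intensity_rpow {q : ℝ} {w : Weight d} (hq : 0 < q) (t : ℝ) (e : Edge d) :
    (|t| * w.edge e ^ (1 / q)) ^ q = |t| ^ q * w.edge e := by
  rw [Real.mul_rpow (abs_nonneg _) (Real.rpow_nonneg (w.edge_pos e).le _),
    ← Real.rpow_mul (w.edge_pos e).le, one_div_mul_cancel hq.ne', Real.rpow_one]

theorem intensity_add {q : ℝ} {w : Weight d} (hq : 1 ≤ q) {J K : Edge d → ℝ}
    (hJ : Summable fun e => |J e| ^ q * w.edge e) (hK : Summable fun e => |K e| ^ q * w.edge e) :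
    (Summable fun e => |J e + K e| ^ q * w.edge e) ∧
      (∑' e, |J e + K e| ^ q * w.edge e) ^ (1 / q) ≤
        (∑' e, |J e| ^ q * w.edge e) ^ (1 / q) + (∑' e, |K e| ^ q * w.edge e) ^ (1 / q) := by
  have hq0 : 0 < q := by linarith
  have hw : ∀ e, 0 ≤ w.edge e ^ (1 / q) := fun e => Real.rpow_nonneg (w.edge_pos e).le _
  have key := Real.Lp_add_le_tsum_of_nonneg (f := fun e => |J e| * w.edge e ^ (1 / q))
    (g := fun e => |K e| * w.edge e ^ (1 / q)) hq
    (fun e => mul_nonneg (abs_nonneg _) (hw e)) (fun e => mul_nonneg (abs_nonneg _) (hw e))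
    (by simpa only [intensity_rpow hq0] using hJ) (by simpa only [intensity_rpow hq0] using hK)
  simp only [intensity_rpow hq0] at key
  have hle : ∀ e, |J e + K e| ^ q * w.edge e ≤
      (|J e| * w.edge e ^ (1 / q) + |K e| * w.edge e ^ (1 / q)) ^ q := fun e => by
    rw [← intensity_rpow hq0, ← add_mul]
    exact Real.rpow_le_rpow (mul_nonneg (abs_nonneg _) (hw e))
      (mul_le_mul_of_nonneg_right (abs_add_le _ _) (hw e)) hq0.le
  have hnn : ∀ e, 0 ≤ |J e + K e| ^ q * w.edge e := fun e =>
    mul_nonneg (Real.rpow_nonneg (abs_nonneg _) _) (w.edge_pos e).le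
  have hs : Summable fun e => |J e + K e| ^ q * w.edge e :=
    Summable.of_nonneg_of_le hnn hle key.1
  refine ⟨hs, le_trans ?_ key.2⟩
  exact Real.rpow_le_rpow (tsum_nonneg hnn) (hs.tsum_le_tsum hle key.1) (by positivity)

/-- `𝒥_q` as a subgroup of `ℝ^E`. -/
def intensitySubgroup [hq : Fact (1 < q)] : AddSubgroup (Edge d → ℝ) where
  carrier := {J | Summable fun e => |J e| ^ q * w.edge e}
  zero_mem' := by
    have : q ≠ 0 := by linarith [hq.out]
    simp [Real.zero_rpow this, summable_zero]
  add_mem' hJ hK := (intensity_add hq.out.le hJ hK).1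
  neg_mem' hJ := by simpa using hJ

/-- The space `𝒥_q = L^q(E, w)` of tempered interaction intensities: the families `J ∈ ℝ^E` with
`‖J‖_q < ∞`. A separate type, so that it carries the norm topology below and
not the topology induced from the product. -/
def Intensity [Fact (1 < q)] : Type := intensitySubgroup q w

variable [hq : Fact (1 < q)]

instance : AddCommGroup (Intensity q w) :=
  inferInstanceAs (AddCommGroup (intensitySubgroup q w))

instance : CoeFun (Intensity q w) (fun _ => Edge d → ℝ) := ⟨fun J => J.1⟩

/-- `‖J‖_q = (∑_{⟨x,y⟩ ∈ E} |J_xy|^q (w x + w y))^{1/q}`. -/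
def Intensity.norm (J : Intensity q w) : ℝ :=
  (∑' e, |J e| ^ q * w.edge e) ^ (1 / q)

instance : NormedAddCommGroup (Intensity q w) :=
  AddGroupNorm.toNormedAddCommGroup
    { toFun := Intensity.norm q w
      map_zero' := by
        have h0 : q ≠ 0 := by linarith [hq.out]
        have h : ∀ e, (0 : Intensity q w) e = 0 := fun _ => rfl
        simp [Intensity.norm, h, Real.zero_rpow h0, Real.zero_rpow (inv_ne_zero h0)]
      add_le' := fun J K => (intensity_add hq.out.le J.2 K.2).2
      neg' := fun J => by
        have h : ∀ e, (-J) e = - J e := fun _ => rfl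
        simp [Intensity.norm, h]
      eq_zero_of_map_eq_zero' := fun J hJ => by
        have h0 : 0 < q := by linarith [hq.out]
        have hnn : ∀ e, 0 ≤ |J e| ^ q * w.edge e := fun e =>
          mul_nonneg (Real.rpow_nonneg (abs_nonneg _) _) (w.edge_pos e).le
        have h1 : ∑' e, |J e| ^ q * w.edge e = 0 :=
          (Real.rpow_eq_zero (tsum_nonneg hnn) (by positivity)).1 hJ
        refine Subtype.ext (funext fun e => ?_)
        have h2 := congrFun ((Summable.hasSum_iff J.2).2 h1 |> (hasSum_zero_iff_of_nonneg hnn).1) e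
        have h3 := (mul_eq_zero.1 h2).resolve_right (w.edge_pos e).ne'
        exact abs_eq_zero.1 ((Real.rpow_eq_zero (abs_nonneg _) h0.ne').1 h3) }

/-- The intensity `J_xy` for neighbours `x ∼ y`, as a function of the two endpoints (set to `0`
on pairs that are not edges, where it is never used). -/
def Intensity.coef {q : ℝ} {w : Weight d} [Fact (1 < q)] (J : Intensity q w) (x y : Site d) : ℝ :=
  open scoped Classical in
  if h : (lattice d).Adj x y then J ⟨s(x, y), h⟩ else 0

end Intensity

/-- The exponent `p = 2q / (q - 1)`. -/
def spinExp (q : ℝ) : ℝ := 2 * q / (q - 1)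

/-- The tempered configurations `𝒮_p = L^p(ℤ^d, w)`, `p = 2q / (q - 1)`. -/
def temperedConfig {d : ℕ} (q : ℝ) (w : Weight d) : Set (Config d) :=
  {σ | Summable fun x => |σ x| ^ spinExp q * w x}

/-- The condition `χ ∈ 𝒦_q` on the single-spin measures: for all `λ > 0`,
`C₊(λ) = sup_x ∫ exp(λ|u|^{2q/(q-1)}) χ_x(du) < ∞` and
`C₋(λ) = inf_x ∫ exp(-λ|u|^{2q/(q-1)}) χ_x(du) > 0`. -/
def SingleSpinCondition {d : ℕ} (q : ℝ) (χ : Site d → ProbabilityMeasure ℝ) : Prop :=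
  ∀ l : ℝ, 0 < l →
    (⨆ x, ∫⁻ u, ENNReal.ofReal (Real.exp (l * |u| ^ spinExp q)) ∂(χ x : Measure ℝ)) < ∞ ∧
    0 < ⨅ x, ∫⁻ u, ENNReal.ofReal (Real.exp (-(l * |u| ^ spinExp q))) ∂(χ x : Measure ℝ)

/-! ### Local Gibbs measures, Gibbs measures, random Gibbs measures -/

section Gibbs

variable {d : ℕ} {q : ℝ} {w : Weight d} [Fact (1 < q)] (χ : Site d → ProbabilityMeasure ℝ)

/-- The spin configuration `σ_Δ × ξ_{Δᶜ}`. -/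
def glue (Δ : Finset (Site d)) (ξ : Config d) (σ : Δ → ℝ) : Config d :=
  Function.updateFinset ξ Δ σ

/-- Minus the energy: `-H_Δ(σ_Δ | J, ξ) = ∑_{⟨x,y⟩ ∈ E_Δ} J_xy σ(x) σ(y)
+ ∑_{x ∈ Δ, y ∈ Δᶜ, x ∼ y} J_xy σ(x) ξ(y)`. -/
def negEnergy (Δ : Finset (Site d)) (J : Intensity q w) (ξ : Config d) (σ : Δ → ℝ) : ℝ :=
  (∑ e ∈ edgesIn Δ, J e * (Sym2.map (glue Δ ξ σ) e.1).mul)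
    + ∑ x : Δ, ∑ y ∈ nbrs x.1 \ Δ, J.coef x.1 y * σ x * ξ y

/-- The product measure `χ_Δ`. -/
def singleSpins (Δ : Finset (Site d)) : Measure (Δ → ℝ) :=
  Measure.pi fun x : Δ => (χ x.1 : Measure ℝ)

/-- The normalizing factor `Z_Δ(J, ξ)`. -/
def partitionFn (Δ : Finset (Site d)) (J : Intensity q w) (ξ : Config d) : ℝ :=
  ∫ σ, Real.exp (negEnergy Δ J ξ σ) ∂(singleSpins χ Δ)

/-- The local Gibbs measure `π_Δ(· | J, ξ)`: the image under `σ_Δ ↦ σ_Δ × ξ_{Δᶜ}` of the measure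
`Z_Δ(J, ξ)⁻¹ exp(-H_Δ(σ_Δ | J, ξ)) χ_Δ(dσ_Δ)`. -/
def localGibbs (Δ : Finset (Site d)) (J : Intensity q w) (ξ : Config d) : Measure (Config d) :=
  ((singleSpins χ Δ).withDensity fun σ =>
    ENNReal.ofReal (Real.exp (negEnergy Δ J ξ σ) / partitionFn χ Δ J ξ)).map (glue Δ ξ)

/-- The set `𝒢_p(J)` of tempered Gibbs measures: `μ(𝒮_p) = 1` and `μ` solves the DLR equation
`∫ π_Δ(A | J, ξ) μ(dξ) = μ(A)` for all Borel `A` and all nonempty finite `Δ`. -/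
def gibbsMeasures (J : Intensity q w) : Set (ProbabilityMeasure (Config d)) :=
  {μ | (μ : Measure (Config d)) (temperedConfig q w) = 1 ∧
    ∀ Δ : Finset (Site d), Δ.Nonempty → ∀ A : Set (Config d), MeasurableSet A →
      ∫⁻ ξ, localGibbs χ Δ J ξ A ∂(μ : Measure (Config d)) = (μ : Measure (Config d)) A}

/-- Random Gibbs measures: maps `J ↦ μ(J) ∈ 𝒫(ℝ^{ℤ^d})`, measurable for the Borel `σ`-field of the
weak topology on `𝒫(ℝ^{ℤ^d})`, with `μ(J) ∈ 𝒢_p(J)` for `ν`-almost all `J`. -/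
structure IsRandomGibbsMeasure [MeasurableSpace (Intensity q w)] (ν : Measure (Intensity q w))
    (μ : Intensity q w → ProbabilityMeasure (Config d)) : Prop where
  measurable : Measurable[_, borel (ProbabilityMeasure (Config d))] μ
  ae_mem : ∀ᵐ J ∂ν, μ J ∈ gibbsMeasures χ J

/-! ### Pressures -/

/-- The local pressure `p_Δ(J, ξ) = |Δ|⁻¹ log Z_Δ(J, ξ)`. -/
def pressure (Δ : Finset (Site d)) (J : Intensity q w) (ξ : Config d) : ℝ :=
  1 / (Δ.card : ℝ) * Real.log (partitionFn χ Δ J ξ)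

/-- The averaged pressure `p_{𝒟,N}(J, ξ) = N⁻¹ ∑_{n=1}^N p_{Δ_n}(J, ξ)`; the sequence `𝒟` is
listed as `D 0, D 1, …`. -/
def avgPressure (D : ℕ → Finset (Site d)) (N : ℕ) (J : Intensity q w) (ξ : Config d) : ℝ :=
  1 / (N : ℝ) * ∑ n ∈ Finset.range N, pressure χ (D n) J ξ

/-- `p̄^μ_{𝒟,N}(J) = ∫ p_{𝒟,N}(J, ξ) μ(J)(dξ)`. -/
def meanAvgPressure (μ : Intensity q w → ProbabilityMeasure (Config d))
    (D : ℕ → Finset (Site d)) (N : ℕ) (J : Intensity q w) : ℝ :=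
  ∫ ξ, avgPressure χ D N J ξ ∂(μ J : Measure (Config d))

/-- The measure `ϑ(dσ, dJ) = μ(J)(dσ) ν(dJ)` on `ℝ^{ℤ^d} × 𝒥_q`. -/
def jointLaw [MeasurableSpace (Intensity q w)] (ν : Measure (Intensity q w))
    (μ : Intensity q w → ProbabilityMeasure (Config d)) : Measure (Config d × Intensity q w) :=
  ν.bind fun J => (μ J : Measure (Config d)).map fun σ => (σ, J)

end Gibbs

end RandomSpin

end

/-! Both convergence statements come from Komlós' theorem: an `L¹`-bounded sequence has a
subsequence whose Cesàro means converge almost everywhere to an integrable limit. It is applied to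
the pressures of the cubes `box d n`, under `jointLaw ν μ` for the second statement and, after
integrating out the configuration, under `ν` for the first. A subsequence of the cubes is still
cofinal. The only input is thus a bound on the `L¹` norm of the pressures that is uniform in the
volume (`exists_lintegral_pressure_le`); no translation invariance or ergodicity enters.

Young's inequality bounds a bond energy by `|J|^q` plus `p`-th powers of spins, so a pressure is
dominated by an average of site terms (`exists_abs_pressure_le`). It remains to bound `E|ξ x|^p`
under the joint law uniformly in `x`. The DLR equation at one site suggests `l E|ξ x|^p ≤ C + 2 ∑_{y
∼ x} (E|J_xy|^q + E|ξ y|^p)`, where `l` may be taken large while the factor 2 stays fixed. For large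
`l` this forces a uniform bound, provided the moments are known to be finite and to grow at most
like `1 / w` (`le_of_mul_le_add_sum_nbrs`).

Temperedness only says that `v = ∑ₓ |ξ x|^p w x` is almost surely finite, which gives no moment at
all. The moments are therefore weighted by `f'(v)`, where `f(v) = v / (1 + ε v)`. The concavity of
`f` carries this weight through the DLR equation (`lintegral_damping_mul_le`), the resulting bound
does not depend on `ε`, and Fatou's lemma removes the weight as `ε → 0`.

Komlós' theorem is proved for nonnegative functions by truncating the `k`-th chosen term at `k + 1`,
centring it at a weak `L²` limit, and choosing terms greedily so that each centred one has almost no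
positive correlation with the preceding sum. Second moments then control the averages along
geometric times, and monotonicity of the partial sums fills the gaps, as in Etemadi's proof of the
strong law. -/

noncomputable section

/-! ### Weak limits and greedy selection in Hilbert space. -/

section Hilbert

variable {H : Type*} [NormedAddCommGroup H] [InnerProductSpace ℝ H]

/-- Banach–Alaoglu, transported by the Riesz isomorphism. An ultrafilter needs no separability, and
a single one serves all truncation levels without a diagonal extraction. -/
theorem exists_ultrafilter_weak_limit [CompleteSpace H] (U : Ultrafilter ℕ) {x : ℕ → H} {C : ℝ}
    (hC : ∀ n, ‖x n‖ ≤ C) :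
    ∃ g : H, ∀ y, Tendsto (fun n => inner ℝ (x n) y) U (𝓝 (inner ℝ g y)) := by
  let T : H → WeakDual ℝ H := fun z => StrongDual.toWeakDual (InnerProductSpace.toDual ℝ H z)
  have hmem : ∀ n, T (x n) ∈ WeakDual.toStrongDual ⁻¹' Metric.closedBall (0 : StrongDual ℝ H) C := by
    intro n
    simp only [Set.mem_preimage, mem_closedBall_zero_iff]
    have : WeakDual.toStrongDual (T (x n)) = InnerProductSpace.toDual ℝ H (x n) := rfl
    rw [this, LinearIsometryEquiv.norm_map]
    exact hC n
  obtain ⟨z, -, hz⟩ := (WeakDual.isCompact_closedBall (0 : StrongDual ℝ H) C).ultrafilter_le_nhds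
    (U.map fun n => T (x n)) (by
      rw [le_principal_iff]
      exact Filter.mem_map.2 (Filter.Eventually.of_forall hmem))
  refine ⟨(InnerProductSpace.toDual ℝ H).symm (WeakDual.toStrongDual z), fun y => ?_⟩
  have h1 : Tendsto (fun n => T (x n)) U (𝓝 z) := hz
  have h2 := ((WeakDual.eval_continuous (𝕜 := ℝ) y).tendsto z).comp h1
  rw [InnerProductSpace.toDual_symm_apply]
  exact h2

/-- With `V` the sum so far, weak convergence allows a late `z = x k n` with `⟨z - g k, V⟩ ≤ 1` and
`⟨z, g k⟩ ≥ ‖g k‖² - 1`. Then `‖z - g k‖² ≤ a k + 3`, and the cross term adds at most 2. Only upper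
bounds on the cross terms are needed. -/
theorem exists_strictMono_norm_sq_sum_sub_le [CompleteSpace H] (U : Ultrafilter ℕ)
    (hU : (U : Filter ℕ) ≤ atTop) {x : ℕ → ℕ → H} {g : ℕ → H} {a : ℕ → ℝ}
    (ha : ∀ k, Tendsto (fun n => ‖x k n‖ ^ 2) U (𝓝 (a k)))
    (hg : ∀ k y, Tendsto (fun n => inner ℝ (x k n) y) U (𝓝 (inner ℝ (g k) y))) :
    ∃ φ : ℕ → ℕ, StrictMono φ ∧ (∀ k, ‖x k (φ k)‖ ^ 2 ≤ a k + 1) ∧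
      ∀ N, ‖∑ k ∈ Finset.range N, (x k (φ k) - g k)‖ ^ 2 ≤ ∑ k ∈ Finset.range N, (a k + 5) := by
  have step : ∀ (k m : ℕ) (V : H), ∃ n, m < n ∧ ‖x k n‖ ^ 2 ≤ a k + 1 ∧
      ‖g k‖ ^ 2 - 1 ≤ inner ℝ (x k n) (g k) ∧ inner ℝ (x k n) V ≤ inner ℝ (g k) V + 1 := by
    intro k m V
    have e1 : ∀ᶠ n in (U : Filter ℕ), m < n := hU (eventually_gt_atTop m)
    have e2 := (ha k).eventually_le_const (lt_add_one (a k))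
    have e3 := (hg k (g k)).eventually_const_le (sub_one_lt _)
    have e4 := (hg k V).eventually_le_const (lt_add_one (inner ℝ (g k) V))
    rw [real_inner_self_eq_norm_sq] at e3
    exact (e1.and (e2.and (e3.and e4))).exists
  choose F hF1 hF2 hF3 hF4 using step
  -- The state of the greedy recursion: the last chosen index and the current centred sum.
  let s : ℕ → ℕ × H := fun N => Nat.rec (0, 0)
    (fun k s => (F k s.1 s.2, s.2 + (x k (F k s.1 s.2) - g k))) N
  have hs : ∀ k, s (k + 1) = (F k (s k).1 (s k).2,
    (s k).2 + (x k (F k (s k).1 (s k).2) - g k)) := fun k => rfl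
  let φ : ℕ → ℕ := fun k => (s (k + 1)).1
  have hφ : ∀ k, φ k = F k (s k).1 (s k).2 := fun k => rfl
  have hV : ∀ N, (s N).2 = ∑ k ∈ Finset.range N, (x k (φ k) - g k) := by
    intro N
    induction N with
    | zero => rfl
    | succ k ih => rw [Finset.sum_range_succ, ← ih, hs, hφ]
  refine ⟨φ, strictMono_nat_of_lt_succ fun k => ?_, fun k => ?_, fun N => ?_⟩
  · rw [hφ (k + 1)]
    exact hF1 _ _ _
  · rw [hφ]
    exact hF2 _ _ _
  · induction N with
    | zero => simp
    | succ k ih =>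
      rw [← hV] at ih ⊢
      rw [Finset.sum_range_succ, hs]
      have h2 := hF2 k (s k).1 (s k).2
      have h3 := hF3 k (s k).1 (s k).2
      have h4 := hF4 k (s k).1 (s k).2
      set V := (s k).2
      set z := x k (F k (s k).1 V)
      dsimp only
      rw [norm_add_sq_real, norm_sub_sq_real, inner_sub_right, real_inner_comm z V,
        real_inner_comm (g k) V]
      have := sq_nonneg ‖g k‖
      linarith

end Hilbert

/-! ### Elementary summation estimates. -/

/-- `2 x` minus `∫₀ˢ min (x / u) 1 ^ 2 du`. -/
def truncTail (x s : ℝ) : ℝ := if s < x then 2 * x - s else x ^ 2 / s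

/-- The sum is a right-endpoint Riemann sum of the nonincreasing function `min (x / u) 1 ^ 2`, whose
integral over `(0, ∞)` is `2 x`. The induction compares each term with the decrease of `truncTail`.
-/
theorem sum_min_sq_div_sq_le {x : ℝ} (hx : 0 ≤ x) (M : ℕ) :
    ∑ k ∈ Finset.range M, (min x (k + 1)) ^ 2 / ((k : ℝ) + 1) ^ 2 ≤ 2 * x := by
  have key : ∑ k ∈ Finset.range M, (min x (k + 1)) ^ 2 / ((k : ℝ) + 1) ^ 2 + truncTail x M
      ≤ 2 * x := by
    induction M with
    | zero =>
      simp only [Finset.range_zero, Finset.sum_empty, truncTail, Nat.cast_zero]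
      split_ifs <;> simp; linarith
    | succ k ih =>
      rw [Finset.sum_range_succ]
      have : (min x (k + 1)) ^ 2 / ((k : ℝ) + 1) ^ 2 + truncTail x (k + 1 : ℕ) ≤ truncTail x k := by
        have hk : (0 : ℝ) ≤ k := k.cast_nonneg
        simp only [truncTail]
        push_cast
        rcases lt_or_ge ((k : ℝ) + 1) x with h | h
        · rw [if_pos h, if_pos (by linarith), min_eq_right h.le, div_self (by positivity)]
          linarith
        · rw [if_neg (not_lt.2 h), min_eq_left h]
          have e : x ^ 2 / ((k : ℝ) + 1) ^ 2 + x ^ 2 / (k + 1) = x ^ 2 * (k + 2) / (k + 1) ^ 2 := by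
            field_simp; ring
          rw [e]
          split_ifs with h'
          · rw [div_le_iff₀ (by positivity)]
            nlinarith [mul_nonneg (sub_nonneg.2 h'.le) (sub_nonneg.2 h),
              mul_nonneg hk (mul_nonneg (sub_nonneg.2 h'.le) (sub_nonneg.2 h)), sq_nonneg (x - k)]
          -- At `k = 0` the formula for `truncTail` divides by zero, but there `x = 0` as well.
          · rcases hk.eq_or_lt with h0 | h0
            · have hx0 : x = 0 := by rw [← h0] at h'; linarith
              simp [hx0]
            · rw [div_le_div_iff₀ (by positivity) h0]
              nlinarith [sq_nonneg x]
      linarith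
  have : 0 ≤ truncTail x M := by
    simp only [truncTail]
    split_ifs <;> [linarith; positivity]
  linarith

theorem exists_ultrafilter_limit_of_bounded (U : Ultrafilter ℕ) {u : ℕ → ℝ} {C : ℝ}
    (h0 : ∀ n, 0 ≤ u n) (hC : ∀ n, u n ≤ C) : ∃ a, Tendsto u U (𝓝 a) := by
  obtain ⟨a, -, ha⟩ := (isCompact_Icc (a := (0 : ℝ)) (b := C)).ultrafilter_le_nhds (U.map u) (by
    rw [le_principal_iff]
    exact Filter.mem_map.2 (Filter.Eventually.of_forall fun n => ⟨h0 n, hC n⟩))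
  exact ⟨a, ha⟩

/-- After exchanging the sums, `b k` is multiplied by the sum of `⌊c ^ m⌋₊⁻²` over those `m` with
`⌊c ^ m⌋₊ > k`. This is essentially a geometric tail, of order `(k + 1)⁻²`. -/
theorem exists_bound_sum_floor_pow {b : ℕ → ℝ} (hb : ∀ k, 0 ≤ b k) {R : ℝ}
    (hR : ∀ K, ∑ k ∈ Finset.range K, b k / ((k : ℝ) + 1) ^ 2 ≤ R) {c : ℝ} (hc : 1 < c) :
    ∃ R', ∀ M, ∑ m ∈ Finset.range M,
      (∑ k ∈ Finset.range ⌊c ^ m⌋₊, b k) / (⌊c ^ m⌋₊ : ℝ) ^ 2 ≤ R' := by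
  have hc0 : 0 < c - 1 := sub_pos.2 hc
  refine ⟨4 * (c ^ 5 * (c - 1)⁻¹ ^ 3) * R, fun M => ?_⟩
  set K := ∑ m ∈ Finset.range M, ⌊c ^ m⌋₊
  -- Halving `k + 1` turns `k + 1 ≤ ⌊c ^ m⌋₊` into the strict inequality that the tail estimate
  -- requires; this is the source of the factor 4.
  have h1 : ∀ m ∈ Finset.range M, (∑ k ∈ Finset.range ⌊c ^ m⌋₊, b k) / (⌊c ^ m⌋₊ : ℝ) ^ 2 ≤
      ∑ k ∈ Finset.range K,
        if ((k : ℝ) + 1) / 2 < ⌊c ^ m⌋₊ then b k * (1 / (⌊c ^ m⌋₊ : ℝ) ^ 2) else 0 := by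
    intro m hm
    rw [Finset.sum_div, ← Finset.sum_filter]
    have hK : ⌊c ^ m⌋₊ ≤ K :=
      Finset.single_le_sum (f := fun m => ⌊c ^ m⌋₊) (fun _ _ => Nat.zero_le _) hm
    simp only [mul_one_div]
    refine Finset.sum_le_sum_of_subset_of_nonneg (fun k hk => ?_) fun k _ _ => by
      have := hb k
      positivity
    rw [Finset.mem_range] at hk
    rw [Finset.mem_filter, Finset.mem_range]
    refine ⟨by omega, ?_⟩
    have h : (k : ℝ) + 1 ≤ ⌊c ^ m⌋₊ := by exact_mod_cast hk
    have hk0 : (0 : ℝ) ≤ k := k.cast_nonneg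
    linarith
  refine (Finset.sum_le_sum h1).trans ?_
  rw [Finset.sum_comm]
  have h2 : ∀ k ∈ Finset.range K, (∑ m ∈ Finset.range M,
      if ((k : ℝ) + 1) / 2 < ⌊c ^ m⌋₊ then b k * (1 / (⌊c ^ m⌋₊ : ℝ) ^ 2) else 0) ≤
      4 * (c ^ 5 * (c - 1)⁻¹ ^ 3) * (b k / ((k : ℝ) + 1) ^ 2) := by
    intro k _
    rw [← Finset.sum_filter, ← Finset.mul_sum]
    have h := sum_div_nat_floor_pow_sq_le_div_sq M (j := ((k : ℝ) + 1) / 2) (by positivity) hc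
    refine (mul_le_mul_of_nonneg_left h (hb k)).trans (le_of_eq ?_)
    field_simp
    ring
  refine (Finset.sum_le_sum h2).trans ?_
  rw [← Finset.mul_sum]
  exact mul_le_mul_of_nonneg_left (hR K) (by positivity)

/-! ### Komlós' theorem. -/

section Measure

variable {Ω : Type*} [MeasurableSpace Ω] {P : Measure Ω}

/-- By Tonelli the series has finite integral, so it converges almost everywhere and its terms
vanish in the limit. This plays the role of Chebyshev with Borel–Cantelli. -/
theorem ae_tendsto_zero_of_sum_integral_le {h : ℕ → Ω → ℝ} (hi : ∀ m, Integrable (h m) P)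
    (h0 : ∀ m ω, 0 ≤ h m ω) {R : ℝ} (hR : ∀ M, ∑ m ∈ Finset.range M, ∫ ω, h m ω ∂P ≤ R) :
    ∀ᵐ ω ∂P, Tendsto (fun m => h m ω) atTop (𝓝 0) := by
  have hm : ∀ m, AEMeasurable (fun ω => ENNReal.ofReal (h m ω)) P :=
    fun m => (hi m).1.aemeasurable.ennreal_ofReal
  have hfin : ∫⁻ ω, ∑' m, ENNReal.ofReal (h m ω) ∂P ≠ ∞ := by
    rw [lintegral_tsum hm]
    refine ne_top_of_le_ne_top (ENNReal.ofReal_ne_top (r := R)) ?_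
    rw [ENNReal.tsum_eq_iSup_nat]
    refine iSup_le fun M => ?_
    have : ∀ m, ∫⁻ ω, ENNReal.ofReal (h m ω) ∂P = ENNReal.ofReal (∫ ω, h m ω ∂P) := fun m =>
      (ofReal_integral_eq_lintegral_ofReal (hi m) (Eventually.of_forall (h0 m))).symm
    simp only [this]
    rw [← ENNReal.ofReal_sum_of_nonneg fun m _ => integral_nonneg (h0 m)]
    exact ENNReal.ofReal_le_ofReal (hR M)
  filter_upwards [ae_lt_top' (AEMeasurable.tsum hm) hfin] with ω hω
  have := (ENNReal.tendsto_toReal ENNReal.zero_ne_top).comp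
    (ENNReal.tendsto_atTop_zero_of_tsum_ne_top hω.ne)
  simpa [Function.comp_def, ENNReal.toReal_ofReal (h0 _ ω)] using this

theorem exists_integrable_ae_tendsto_of_monotone {G : ℕ → Ω → ℝ} (hi : ∀ k, Integrable (G k) P)
    (h0 : ∀ k, 0 ≤ᵐ[P] G k) (hmono : ∀ k, G k ≤ᵐ[P] G (k + 1)) {B : ℝ}
    (hB : ∀ k, ∫ ω, G k ω ∂P ≤ B) :
    ∃ g, Integrable g P ∧ ∀ᵐ ω ∂P, Tendsto (fun k => G k ω) atTop (𝓝 (g ω)) := by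
  have hm : ∀ k, AEMeasurable (fun ω => ENNReal.ofReal (G k ω)) P :=
    fun k => (hi k).1.aemeasurable.ennreal_ofReal
  have hM : ∀ᵐ ω ∂P, Monotone fun k => ENNReal.ofReal (G k ω) := by
    filter_upwards [ae_all_iff.2 hmono] with ω hω
    exact monotone_nat_of_le_succ fun k => ENNReal.ofReal_le_ofReal (hω k)
  have hfin : ∫⁻ ω, ⨆ k, ENNReal.ofReal (G k ω) ∂P ≠ ∞ := by
    rw [lintegral_iSup' hm hM]
    refine ne_top_of_le_ne_top (ENNReal.ofReal_ne_top (r := B)) (iSup_le fun k => ?_)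
    rw [← ofReal_integral_eq_lintegral_ofReal (hi k) (h0 k)]
    exact ENNReal.ofReal_le_ofReal (hB k)
  refine ⟨fun ω => (⨆ k, ENNReal.ofReal (G k ω)).toReal,
    integrable_toReal_of_lintegral_ne_top (AEMeasurable.iSup hm) hfin, ?_⟩
  filter_upwards [ae_lt_top' (AEMeasurable.iSup hm) hfin, hM, ae_all_iff.2 h0] with ω h1 h2 h3
  have := (ENNReal.tendsto_toReal h1.ne).comp (tendsto_atTop_iSup h2)
  refine this.congr fun k => ?_
  simp only [Function.comp_apply]
  exact ENNReal.toReal_ofReal (h3 k)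

/-- The second moments at level `k + 1` may grow with `k`, but their sum weighted by `(k + 1)⁻²` is
controlled by the first moment: `sum_min_sq_div_sq_le` is integrated for fixed `n` before passing to
the limit. Order relations survive weak limits when tested on indicators. -/
theorem exists_ultrafilter_truncation_limits [IsFiniteMeasure P] (U : Ultrafilter ℕ)
    {f : ℕ → Ω → ℝ} (hf : ∀ n, Integrable (f n) P) (h0 : ∀ n ω, 0 ≤ f n ω) {B : ℝ}
    (hB : ∀ n, ∫ ω, f n ω ∂P ≤ B) (X : ℕ → ℕ → Lp ℝ 2 P)
    (hX : ∀ k n, X k n =ᵐ[P] fun ω => min (f n ω) (k + 1)) :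
    ∃ (a : ℕ → ℝ) (G : ℕ → Lp ℝ 2 P),
      (∀ k, Tendsto (fun n => ‖X k n‖ ^ 2) U (𝓝 (a k))) ∧
      (∀ k y, Tendsto (fun n => inner ℝ (X k n) y) U (𝓝 (inner ℝ (G k) y))) ∧
      (∀ k, 0 ≤ a k) ∧
      (∀ K, ∑ k ∈ Finset.range K, a k / ((k : ℝ) + 1) ^ 2 ≤ 2 * B) ∧
      (∀ k, 0 ≤ᵐ[P] G k) ∧ (∀ k, G k ≤ᵐ[P] G (k + 1)) ∧ (∀ k, ∫ ω, G k ω ∂P ≤ B) := by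
  have hXb : ∀ k, ∃ C, ∀ n, ‖X k n‖ ≤ C := fun k => ⟨_, fun n =>
    Lp.norm_le_of_ae_bound (C := (k : ℝ) + 1) (by positivity) (by
      filter_upwards [hX k n] with ω hω
      rw [hω, Real.norm_of_nonneg (le_min (h0 n ω) (by positivity))]
      exact min_le_right _ _)⟩
  have hXn : ∀ k n, ‖X k n‖ ^ 2 = ∫ ω, (min (f n ω) (k + 1)) ^ 2 ∂P := by
    intro k n
    rw [← real_inner_self_eq_norm_sq, L2.inner_def]
    refine integral_congr_ae ?_
    filter_upwards [hX k n] with ω hω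
    simp only [hω, real_inner_self_eq_norm_sq, Real.norm_eq_abs, sq_abs]
  have hXs : ∀ k n : ℕ, Integrable (fun ω => (min (f n ω) (k + 1)) ^ 2) P := fun k n => by
    refine (Lp.memLp (X k n)).integrable_sq.congr ?_
    filter_upwards [hX k n] with ω hω
    rw [hω]
  choose C hC using hXb
  choose G hG using fun k => exists_ultrafilter_weak_limit U (hC k)
  choose a ha using fun k => exists_ultrafilter_limit_of_bounded U (u := fun n => ‖X k n‖ ^ 2)
    (C := C k ^ 2) (fun n => by positivity)
    (fun n => pow_le_pow_left₀ (norm_nonneg _) (hC k n) 2)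
  -- Indicators lie in `L²` because `P` is finite, so they are admissible test vectors.
  have hset : ∀ (k : ℕ) (A : Set Ω), MeasurableSet A →
      Tendsto (fun n => ∫ ω in A, min (f n ω) (k + 1) ∂P) U (𝓝 (∫ ω in A, G k ω ∂P)) := by
    intro k A hA
    have := hG k (indicatorConstLp 2 hA (measure_ne_top P A) (1 : ℝ))
    simp only [real_inner_comm (indicatorConstLp 2 hA (measure_ne_top P A) (1 : ℝ)) _] at this
    simp only [L2.inner_indicatorConstLp_one] at this
    refine this.congr fun n => ?_
    refine integral_congr_ae (ae_restrict_of_ae (hX k n))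
  have hmin : ∀ k n : ℕ, Integrable (fun ω => min (f n ω) ((k : ℝ) + 1)) P := fun k n =>
    (hf n).inf (integrable_const _)
  have hGi : ∀ k, Integrable (G k) P := fun k => (Lp.memLp (G k)).integrable one_le_two
  refine ⟨a, G, ha, hG, fun k => ge_of_tendsto' (ha k) fun n => by positivity, fun K => ?_,
    fun k => ?_, fun k => ?_, fun k => ?_⟩
  · refine le_of_tendsto' (tendsto_finsetSum _ fun k _ => (ha k).div_const _) fun n => ?_
    simp only [hXn, ← integral_div]
    rw [← integral_finsetSum _ fun k _ => (hXs k n).div_const _]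
    calc _ ≤ ∫ ω, 2 * f n ω ∂P := integral_mono
          (integrable_finsetSum _ fun k _ => (hXs k n).div_const _) ((hf n).const_mul 2)
          fun ω => sum_min_sq_div_sq_le (h0 n ω) K
      _ ≤ 2 * B := by
          rw [integral_const_mul]
          exact mul_le_mul_of_nonneg_left (hB n) zero_le_two
  · refine ae_nonneg_of_forall_setIntegral_nonneg (hGi k) fun A hA _ => ?_
    exact ge_of_tendsto' (hset k A hA) fun n =>
      integral_nonneg fun ω => le_min (h0 n ω) (by positivity)
  · refine ae_le_of_forall_setIntegral_le (hGi k) (hGi (k + 1)) fun A hA _ => ?_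
    refine le_of_tendsto_of_tendsto' (hset k A hA) (hset (k + 1) A hA) fun n => ?_
    refine integral_mono (hmin k n).integrableOn (hmin (k + 1) n).integrableOn fun ω => ?_
    refine min_le_min_left _ ?_
    push_cast
    linarith
  · have := hset k Set.univ MeasurableSet.univ
    simp only [Measure.restrict_univ] at this
    refine le_of_tendsto' this fun n => le_trans ?_ (hB n)
    exact integral_mono (hmin k n) (hf n) fun ω => min_le_left _ _

/-- **Komlós' theorem** for nonnegative functions. -/
theorem exists_strictMono_cesaro_tendsto_of_nonneg [IsFiniteMeasure P]
    {f : ℕ → Ω → ℝ} (hf : ∀ n, Integrable (f n) P) (h0 : ∀ n ω, 0 ≤ f n ω) {B : ℝ}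
    (hB : ∀ n, ∫ ω, f n ω ∂P ≤ B) :
    ∃ φ : ℕ → ℕ, StrictMono φ ∧ ∃ g, Integrable g P ∧
      ∀ᵐ ω ∂P, Tendsto (fun N : ℕ => (N : ℝ)⁻¹ * ∑ k ∈ Finset.range N, f (φ k) ω) atTop
        (𝓝 (g ω)) := by
  have hmem : ∀ k n : ℕ, MemLp (fun ω => min (f n ω) ((k : ℝ) + 1)) 2 P := fun k n =>
    MemLp.of_bound ((hf n).inf (integrable_const _)).1 ((k : ℝ) + 1) (Eventually.of_forall fun ω => by
      rw [Real.norm_of_nonneg (le_min (h0 n ω) (by positivity))]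
      exact min_le_right _ _)
  let X : ℕ → ℕ → Lp ℝ 2 P := fun k n => (hmem k n).toLp
  have hX : ∀ k n, X k n =ᵐ[P] fun ω => min (f n ω) (k + 1) := fun k n => (hmem k n).coeFn_toLp
  obtain ⟨a, G, ha, hG, ha0, hsum, hG0, hGm, hGB⟩ :=
    exists_ultrafilter_truncation_limits (hyperfilter ℕ) hf h0 hB X hX
  have hU : (hyperfilter ℕ : Filter ℕ) ≤ atTop := by
    rw [← Nat.cofinite_eq_atTop]
    exact hyperfilter_le_cofinite
  obtain ⟨φ, hφ, hφ1, hφ2⟩ := exists_strictMono_norm_sq_sum_sub_le (hyperfilter ℕ) hU ha hG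
  have hGi : ∀ k, Integrable (G k) P := fun k => (Lp.memLp (G k)).integrable one_le_two
  obtain ⟨g, hg, hgt⟩ := exists_integrable_ae_tendsto_of_monotone hGi hG0 hGm hGB
  refine ⟨φ, hφ, g, hg, ?_⟩
  -- The bound `∑ 1 / (k + 1)² ≤ 2` is the case `x = 1` of `sum_min_sq_div_sq_le`.
  have hR : ∀ K, ∑ k ∈ Finset.range K, (a k + 5) / ((k : ℝ) + 1) ^ 2 ≤ 2 * B + 5 * 2 := by
    intro K
    simp only [add_div, Finset.sum_add_distrib]
    refine add_le_add (hsum K) ?_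
    have := sum_min_sq_div_sq_le zero_le_one K
    have h1 : ∀ k : ℕ, min (1 : ℝ) (k + 1) = 1 := fun k =>
      min_eq_left (by have : (0 : ℝ) ≤ k := k.cast_nonneg
                      linarith)
    simp only [h1, one_pow] at this
    simp only [div_eq_mul_inv (5 : ℝ), ← Finset.mul_sum, ← one_div]
    linarith
  have hsq : ∀ V : Lp ℝ 2 P, ‖V‖ ^ 2 = ∫ ω, V ω ^ 2 ∂P := by
    intro V
    rw [← real_inner_self_eq_norm_sq, L2.inner_def]
    simp only [real_inner_self_eq_norm_sq, Real.norm_eq_abs, sq_abs]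
  -- the truncations are inactive from some index on
  have hA : ∀ᵐ ω ∂P, Tendsto (fun k : ℕ => (X k (φ k) ω) ^ 2 / ((k : ℝ) + 1) ^ 2) atTop (𝓝 0) := by
    refine ae_tendsto_zero_of_sum_integral_le (R := 2 * B + 5 * 2)
      (fun k => (Lp.memLp (X k (φ k))).integrable_sq.div_const _) (fun k ω => by positivity)
      fun M => (Finset.sum_le_sum fun k _ => ?_).trans (hR M)
    rw [integral_div, ← hsq]
    have := hφ1 k
    gcongr
    linarith
  -- the centred sums along geometric subsequences
  let V : ℕ → Lp ℝ 2 P := fun N => ∑ k ∈ Finset.range N, (X k (φ k) - G k)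
  let c : ℕ → ℝ := fun j => 1 + 1 / ((j : ℝ) + 1)
  have hc1 : ∀ j, 1 < c j := fun j => lt_add_of_pos_right 1 (by positivity)
  have hc2 : Tendsto c atTop (𝓝 1) := by
    simpa [c] using (tendsto_one_div_add_atTop_nhds_zero_nat (𝕜 := ℝ)).const_add 1
  have hC : ∀ j, ∀ᵐ ω ∂P, Tendsto
      (fun m : ℕ => (V ⌊c j ^ m⌋₊ ω) ^ 2 / (⌊c j ^ m⌋₊ : ℝ) ^ 2) atTop (𝓝 0) := by
    intro j
    obtain ⟨R', hR'⟩ := exists_bound_sum_floor_pow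
      (fun k => add_nonneg (ha0 k) (by norm_num : (0 : ℝ) ≤ 5)) hR (hc1 j)
    refine ae_tendsto_zero_of_sum_integral_le (R := R')
      (fun k => (Lp.memLp (V _)).integrable_sq.div_const _) (fun k ω => by positivity)
      fun M => (Finset.sum_le_sum fun m _ => ?_).trans (hR' M)
    rw [integral_div, ← hsq]
    have := hφ2 ⌊c j ^ m⌋₊
    gcongr
  have hVcoe : ∀ᵐ ω ∂P, ∀ N, V N ω = ∑ k ∈ Finset.range N, (min (f (φ k) ω) (k + 1) - G k ω) := by
    refine ae_all_iff.2 fun N => ?_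
    have h1 : ∀ᵐ ω ∂P, ∀ k, (X k (φ k) - G k : Lp ℝ 2 P) ω = X k (φ k) ω - G k ω :=
      ae_all_iff.2 fun k => Lp.coeFn_sub _ _
    have h2 : V N =ᵐ[P] ∑ k ∈ Finset.range N, ⇑(X k (φ k) - G k) :=
      Lp.coeFn_finsetSum _ _
    filter_upwards [h1, h2, ae_all_iff.2 fun k => hX k (φ k)] with ω h1 h2 h3
    rw [h2, Finset.sum_apply]
    exact Finset.sum_congr rfl fun k _ => by rw [h1, h3]
  filter_upwards [hA, ae_all_iff.2 hC, hVcoe, hgt, ae_all_iff.2 fun k => hX k (φ k)]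
    with ω h1 h2 h3 h4 h5
  let u : ℕ → ℝ := fun k => min (f (φ k) ω) (k + 1)
  have hu0 : ∀ k, 0 ≤ u k := fun k => le_min (h0 _ ω) (by positivity)
  -- Nonnegativity makes the partial sums monotone, so convergence along `⌊c j ^ m⌋₊` for ratios `c
  -- j` tending to 1 implies convergence along all integers.
  have hS : Tendsto (fun N : ℕ => (∑ k ∈ Finset.range N, u k) / (N : ℝ)) atTop (𝓝 (g ω)) := by
    refine tendsto_div_of_monotone_of_tendsto_div_floor_pow
      (fun N => ∑ k ∈ Finset.range N, u k) (g ω) (fun M N hMN =>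
        Finset.sum_le_sum_of_subset_of_nonneg (Finset.range_mono hMN) fun k _ _ => hu0 k)
      c hc1 hc2 fun j => ?_
    have hV0 : Tendsto (fun m : ℕ => V ⌊c j ^ m⌋₊ ω / (⌊c j ^ m⌋₊ : ℝ)) atTop (𝓝 0) := by
      have := (h2 j).sqrt
      simp only [Real.sqrt_zero, ← div_pow, Real.sqrt_sq_eq_abs] at this
      exact (tendsto_zero_iff_abs_tendsto_zero _).2 this
    have hces := h4.cesaro.comp
      (tendsto_nat_floor_atTop.comp (tendsto_pow_atTop_atTop_of_one_lt (hc1 j)))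
    have := hV0.add hces
    rw [zero_add] at this
    refine this.congr fun m => ?_
    simp only [Function.comp_apply]
    rw [h3, Finset.sum_sub_distrib, sub_div, div_eq_inv_mul _ (_ : ℝ), div_eq_inv_mul _ (_ : ℝ)]
    ring
  have hev : Tendsto (fun k => f (φ k) ω - u k) atTop (𝓝 0) := by
    refine tendsto_const_nhds.congr' ?_
    filter_upwards [h1.eventually_lt_const one_pos] with k hk
    rw [h5, div_lt_one (by positivity)] at hk
    have hlt : u k < k + 1 := lt_of_pow_lt_pow_left₀ 2 (by positivity) hk
    have : u k = f (φ k) ω := min_eq_left (by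
      by_contra hcon
      exact hlt.ne (min_eq_right (not_le.1 hcon).le))
    rw [this, sub_self]
  have := hev.cesaro.add hS
  rw [zero_add] at this
  refine this.congr fun N => ?_
  rw [Finset.sum_sub_distrib, div_eq_inv_mul]
  ring

/-- **Komlós' theorem**: a sequence bounded in `L¹` has a subsequence whose averages converge
almost everywhere to an integrable function. -/
theorem exists_strictMono_cesaro_tendsto [IsFiniteMeasure P]
    {f : ℕ → Ω → ℝ} (hf : ∀ n, Integrable (f n) P) {B : ℝ} (hB : ∀ n, ∫ ω, |f n ω| ∂P ≤ B) :
    ∃ φ : ℕ → ℕ, StrictMono φ ∧ ∃ g, Integrable g P ∧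
      ∀ᵐ ω ∂P, Tendsto (fun N : ℕ => (N : ℝ)⁻¹ * ∑ k ∈ Finset.range N, f (φ k) ω) atTop
        (𝓝 (g ω)) := by
  have hpos : ∀ n, Integrable (fun ω => max (f n ω) 0) P := fun n => (hf n).pos_part
  have hneg : ∀ n, Integrable (fun ω => max (-f n ω) 0) P := fun n => (hf n).neg_part
  -- Positive and negative parts must share one subsequence; placing them on two disjoint copies of
  -- `Ω` makes them a single nonnegative sequence.
  let F : ℕ → Ω ⊕ Ω → ℝ := fun n => Sum.elim (fun ω => max (f n ω) 0) fun ω => max (-f n ω) 0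
  let Q : Measure (Ω ⊕ Ω) := P.map Sum.inl + P.map Sum.inr
  have hl : MeasurableEmbedding (Sum.inl : Ω → Ω ⊕ Ω) := ⟨Sum.inl_injective, measurable_inl, fun _ h => h.inl_image⟩
  have hr : MeasurableEmbedding (Sum.inr : Ω → Ω ⊕ Ω) :=
    ⟨Sum.inr_injective, measurable_inr, fun _ h => h.inr_image⟩
  have hFl : ∀ n, Integrable (F n) (P.map Sum.inl) := fun n => hl.integrable_map_iff.2 (hpos n)
  have hFr : ∀ n, Integrable (F n) (P.map Sum.inr) := fun n => hr.integrable_map_iff.2 (hneg n)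
  obtain ⟨φ, hφ, g, hg, hlim⟩ := exists_strictMono_cesaro_tendsto_of_nonneg (P := Q) (f := F)
    (B := B) (fun n => (hFl n).add_measure (hFr n))
    (fun n ω => by cases ω <;> exact le_max_right _ _) (fun n => by
      rw [integral_add_measure (hFl n) (hFr n), hl.integral_map, hr.integral_map]
      simp only [F, Sum.elim_inl, Sum.elim_inr]
      rw [← integral_add (hpos n) (hneg n)]
      refine le_trans (le_of_eq (integral_congr_ae (Eventually.of_forall fun ω => ?_))) (hB n)
      dsimp only
      rcases le_total 0 (f n ω) with h | h
      · rw [max_eq_left h, max_eq_right (neg_nonpos.2 h), abs_of_nonneg h, add_zero]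
      · rw [max_eq_right h, max_eq_left (neg_nonneg.2 h), abs_of_nonpos h, zero_add])
  rw [integrable_add_measure, hl.integrable_map_iff, hr.integrable_map_iff] at hg
  rw [ae_add_measure_iff, hl.ae_map_iff, hr.ae_map_iff] at hlim
  refine ⟨φ, hφ, fun ω => g (Sum.inl ω) - g (Sum.inr ω), hg.1.sub hg.2, ?_⟩
  filter_upwards [hlim.1, hlim.2] with ω h1 h2
  refine (h1.sub h2).congr fun N => ?_
  rw [← mul_sub, ← Finset.sum_sub_distrib]
  congr 1
  refine Finset.sum_congr rfl fun k _ => ?_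
  simp only [F, Sum.elim_inl, Sum.elim_inr]
  rcases le_total 0 (f (φ k) ω) with h | h
  · rw [max_eq_left h, max_eq_right (neg_nonpos.2 h), sub_zero]
  · rw [max_eq_right h, max_eq_left (neg_nonneg.2 h), zero_sub, neg_neg]

end Measure

namespace RandomSpin

/-! ### Energy bounds. -/

section Energy

variable {d : ℕ} {q : ℝ}

/-- Young's inequality with exponents `q` and `q' = q / (q - 1)`, followed by `|a b|^{q'} ≤ max(|a|,
|b|)^{2q'}`. Here `p = 2q'` is exactly the exponent required. -/
theorem abs_mul_mul_le_rpow (hq : 1 < q) (j a b : ℝ) :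
    |j * a * b| ≤ |j| ^ q + |a| ^ spinExp q + |b| ^ spinExp q := by
  have hc := Real.HolderConjugate.conjExponent hq
  have hy := Real.young_inequality_of_nonneg (abs_nonneg j) (abs_nonneg (a * b)) hc
  have h1 : |j| ^ q / q ≤ |j| ^ q := div_le_self (by positivity) hq.le
  have h2 : |a * b| ^ q.conjExponent / q.conjExponent ≤ |a * b| ^ q.conjExponent :=
    div_le_self (by positivity) hc.symm.lt.le
  have hp : spinExp q = 2 * q.conjExponent := by
    rw [spinExp, Real.conjExponent, mul_div_assoc]
  have key : ∀ u v : ℝ, |u| ≤ |v| → |u * v| ^ q.conjExponent ≤ |v| ^ spinExp q := by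
    intro u v h
    rw [hp, Real.rpow_mul (abs_nonneg v)]
    refine Real.rpow_le_rpow (abs_nonneg _) ?_ hc.symm.nonneg
    rw [abs_mul, Real.rpow_two, sq]
    exact mul_le_mul_of_nonneg_right h (abs_nonneg v)
  have h3 : |a * b| ^ q.conjExponent ≤ |a| ^ spinExp q + |b| ^ spinExp q := by
    have ha : 0 ≤ |a| ^ spinExp q := by positivity
    have hb : 0 ≤ |b| ^ spinExp q := by positivity
    rcases le_total |a| |b| with h | h
    · linarith [key a b h]
    · linarith [mul_comm a b ▸ key b a h]
  rw [mul_assoc, abs_mul]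
  linarith

theorem card_nbrs_le (x : Site d) : ((nbrs x).card : ℝ) ≤ 3 ^ d := by
  have : (nbrs x).card ≤ 3 ^ d := by
    refine (Finset.card_le_card (t := Finset.Icc (fun i => x i - 1) fun i => x i + 1) fun y hy => by
      simp only [nbrs, Finset.mem_filter] at hy
      exact hy.1).trans (le_of_eq ?_)
    rw [Pi.card_Icc]
    have : ∀ i, (Finset.Icc (x i - 1) (x i + 1)).card = 3 := fun i => by
      rw [Int.card_Icc]
      omega
    simp [this]
  exact_mod_cast this

variable {w : Weight d} [hq : Fact (1 < q)]

/-- A bound for the influence on the spin at `x` of the bonds and spins next to it. -/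
def siteSource (J : Intensity q w) (ξ : Config d) (x : Site d) : ℝ :=
  ∑ y ∈ nbrs x, (|J.coef x y| ^ q + |ξ y| ^ spinExp q)

theorem siteSource_nonneg (J : Intensity q w) (ξ : Config d) (x : Site d) :
    0 ≤ siteSource J ξ x :=
  Finset.sum_nonneg fun _ _ => by positivity

theorem sum_edgesIn_le (Δ : Finset (Site d)) (J : Intensity q w) (η : Config d) :
    ∑ e ∈ edgesIn Δ, |J e * (Sym2.map η e.1).mul| ≤
      ∑ x ∈ Δ, ∑ y ∈ nbrs x with y ∈ Δ, |J.coef x y * η x * η y| := by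
  classical
  rw [Finset.sum_sigma']
  -- Orienting each edge arbitrarily embeds the edges in the ordered pairs; the unused orientations
  -- contribute nonnegative terms.
  let i : Edge d → (_ : Site d) × Site d := fun e => ⟨(Quot.out e.1).1, (Quot.out e.1).2⟩
  have hi : ∀ e : Edge d, e.1 = s((i e).1, (i e).2) := fun e => (Quot.out_eq e.1).symm
  have hinj : Function.Injective i := fun e e' h => Subtype.ext (by rw [hi e, hi e', h])
  have hadj : ∀ e : Edge d, (lattice d).Adj (i e).1 (i e).2 := fun e => by
    have := e.2
    rw [hi e] at this
    exact this
  have hF : ∀ e : Edge d, J e * (Sym2.map η e.1).mul =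
      J.coef (i e).1 (i e).2 * η (i e).1 * η (i e).2 := by
    intro e
    have h1 : J.coef (i e).1 (i e).2 = J e := by
      rw [Intensity.coef, dif_pos (hadj e)]
      exact congrArg _ (Subtype.ext (hi e).symm)
    rw [h1, hi e, Sym2.map_mk, Sym2.mul_mk, mul_assoc]
  simp only [hF]
  rw [← Finset.sum_image (g := i)
    (f := fun z : (_ : Site d) × Site d => |J.coef z.1 z.2 * η z.1 * η z.2|) (hinj.injOn)]
  refine Finset.sum_le_sum_of_subset_of_nonneg (fun z hz => ?_) fun _ _ _ => abs_nonneg _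
  obtain ⟨e, he, rfl⟩ := Finset.mem_image.1 hz
  rw [edgesIn, Finset.mem_subtype, hi e, Finset.mk_mem_sym2_iff] at he
  rw [Finset.mem_sigma, Finset.mem_filter, mem_nbrs]
  exact ⟨he.1, hadj e, he.2⟩

/-- A spin inside `Δ` enters as first and as second endpoint of ordered pairs, at most `3 ^ d` times
each, whence `2 * 3 ^ d`. Letting `siteSource` count all neighbours, even those in `Δ`,
overestimates but makes the bound additive over sites. -/
theorem abs_negEnergy_le (Δ : Finset (Site d)) (J : Intensity q w) (ξ : Config d) (σ : Δ → ℝ) :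
    |negEnergy Δ J ξ σ| ≤
      2 * 3 ^ d * ∑ x : Δ, |σ x| ^ spinExp q + ∑ x ∈ Δ, siteSource J ξ x := by
  classical
  set η := glue Δ ξ σ with hη
  have hin : ∀ x : Δ, η x = σ x := fun x => by
    simp [hη, glue, Function.updateFinset]
  have hbd : |∑ x : Δ, ∑ y ∈ nbrs x.1 \ Δ, J.coef x.1 y * σ x * ξ y| ≤
      ∑ x ∈ Δ, ∑ y ∈ nbrs x \ Δ, (|J.coef x y| ^ q + |η x| ^ spinExp q + |ξ y| ^ spinExp q) := by
    rw [← Finset.sum_coe_sort Δ]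
    refine (Finset.abs_sum_le_sum_abs _ _).trans (Finset.sum_le_sum fun x _ => ?_)
    refine (Finset.abs_sum_le_sum_abs _ _).trans (Finset.sum_le_sum fun y _ => ?_)
    rw [hin]
    exact abs_mul_mul_le_rpow hq.out _ _ _
  have hbulk : |∑ e ∈ edgesIn Δ, J e * (Sym2.map η e.1).mul| ≤
      ∑ x ∈ Δ, ∑ y ∈ nbrs x with y ∈ Δ,
        (|J.coef x y| ^ q + |η x| ^ spinExp q + |η y| ^ spinExp q) :=
    ((Finset.abs_sum_le_sum_abs _ _).trans (sum_edgesIn_le Δ J η)).trans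
      (Finset.sum_le_sum fun x _ => Finset.sum_le_sum fun y _ => abs_mul_mul_le_rpow hq.out _ _ _)
  have hswap : ∑ x ∈ Δ, ∑ y ∈ nbrs x with y ∈ Δ, |η y| ^ spinExp q ≤
      ∑ x ∈ Δ, 3 ^ d * |η x| ^ spinExp q := by
    rw [Finset.sum_comm' (t' := Δ) (s' := fun y => (nbrs y).filter (· ∈ Δ)) (fun x y => by
      simp only [Finset.mem_filter, mem_nbrs, (lattice d).adj_comm x y]
      tauto)]
    refine Finset.sum_le_sum fun y _ => ?_
    rw [Finset.sum_const, nsmul_eq_mul]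
    refine mul_le_mul_of_nonneg_right (le_trans ?_ (card_nbrs_le y)) (by positivity)
    exact_mod_cast Finset.card_filter_le _ _
  have hσ : ∑ x : Δ, |σ x| ^ spinExp q = ∑ x ∈ Δ, |η x| ^ spinExp q := by
    rw [← Finset.sum_coe_sort Δ]
    exact Finset.sum_congr rfl fun x _ => by rw [hin]
  have hsite : ∀ x ∈ Δ, (∑ y ∈ nbrs x with y ∈ Δ, (|J.coef x y| ^ q + |η x| ^ spinExp q)) +
      ∑ y ∈ nbrs x \ Δ, (|J.coef x y| ^ q + |η x| ^ spinExp q + |ξ y| ^ spinExp q) ≤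
      3 ^ d * |η x| ^ spinExp q + siteSource J ξ x := by
    intro x _
    have e1 := Finset.sum_filter_add_sum_filter_not (nbrs x) (· ∈ Δ)
      fun y => |J.coef x y| ^ q + |η x| ^ spinExp q
    rw [← Finset.sdiff_eq_filter] at e1
    have e2 : ∑ y ∈ nbrs x \ Δ, |ξ y| ^ spinExp q ≤ ∑ y ∈ nbrs x, |ξ y| ^ spinExp q :=
      Finset.sum_le_sum_of_subset_of_nonneg Finset.sdiff_subset fun _ _ _ => by positivity
    have e3 : ∑ y ∈ nbrs x, |η x| ^ spinExp q ≤ 3 ^ d * |η x| ^ spinExp q := by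
      rw [Finset.sum_const, nsmul_eq_mul]
      exact mul_le_mul_of_nonneg_right (card_nbrs_le x) (by positivity)
    rw [Finset.sum_add_distrib (f := fun y => |J.coef x y| ^ q + |η x| ^ spinExp q), ← add_assoc,
      e1, siteSource, Finset.sum_add_distrib, Finset.sum_add_distrib]
    linarith
  have hsites := Finset.sum_le_sum hsite
  rw [Finset.sum_add_distrib, Finset.sum_add_distrib] at hsites
  simp only [Finset.sum_add_distrib (f := fun y => |J.coef _ y| ^ q + |η _| ^ spinExp q)
    (g := fun y => |η y| ^ spinExp q)] at hbulk
  rw [Finset.sum_add_distrib] at hbulk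
  rw [← Finset.mul_sum] at hswap hsites
  rw [hσ]
  refine (abs_add_le _ _).trans ?_
  linarith

end Energy

/-! ### Uniform exponential moments of the reference measures. -/

section SingleSpin

variable {d : ℕ} {q : ℝ} {χ : Site d → ProbabilityMeasure ℝ}

theorem measurable_abs_rpow (r : ℝ) : Measurable fun u : ℝ => |u| ^ r :=
  measurable_id.abs.pow_const r

theorem SingleSpinCondition.exists_bounds (hχ : SingleSpinCondition q χ) {l : ℝ} (hl : 0 < l) :
    ∃ A α : ℝ, 1 ≤ A ∧ 0 < α ∧ α ≤ 1 ∧ ∀ x,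
      Integrable (fun u => Real.exp (l * |u| ^ spinExp q)) (χ x : Measure ℝ) ∧
      Integrable (fun u => Real.exp (-(l * |u| ^ spinExp q))) (χ x : Measure ℝ) ∧
      ∫ u, Real.exp (l * |u| ^ spinExp q) ∂(χ x : Measure ℝ) ≤ A ∧
      α ≤ ∫ u, Real.exp (-(l * |u| ^ spinExp q)) ∂(χ x : Measure ℝ) := by
  obtain ⟨h1, h2⟩ := hχ l hl
  set S := ⨆ x, ∫⁻ u, ENNReal.ofReal (Real.exp (l * |u| ^ spinExp q)) ∂(χ x : Measure ℝ)
  set I := ⨅ x, ∫⁻ u, ENNReal.ofReal (Real.exp (-(l * |u| ^ spinExp q))) ∂(χ x : Measure ℝ)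
  have hm : Measurable fun u : ℝ => l * |u| ^ spinExp q := (measurable_abs_rpow _).const_mul l
  have hint : ∀ x, Integrable (fun u => Real.exp (l * |u| ^ spinExp q)) (χ x : Measure ℝ) := by
    intro x
    refine ⟨hm.exp.aestronglyMeasurable, ?_⟩
    rw [hasFiniteIntegral_iff_ofReal (Eventually.of_forall fun u => (Real.exp_pos _).le)]
    exact (le_iSup (fun x => ∫⁻ u, ENNReal.ofReal (Real.exp (l * |u| ^ spinExp q))
      ∂(χ x : Measure ℝ)) x).trans_lt h1
  have hint' : ∀ x, Integrable (fun u => Real.exp (-(l * |u| ^ spinExp q))) (χ x : Measure ℝ) := by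
    intro x
    refine Integrable.of_bound hm.neg.exp.aestronglyMeasurable 1 (Eventually.of_forall fun u => ?_)
    rw [Real.norm_of_nonneg (Real.exp_pos _).le, Real.exp_le_one_iff, Left.neg_nonpos_iff]
    positivity
  have hlow : ∀ x, I ≤ ENNReal.ofReal
      (∫ u, Real.exp (-(l * |u| ^ spinExp q)) ∂(χ x : Measure ℝ)) := by
    intro x
    rw [ofReal_integral_eq_lintegral_ofReal (hint' x)
      (Eventually.of_forall fun u => (Real.exp_pos _).le)]
    exact iInf_le (fun x => ∫⁻ u, ENNReal.ofReal (Real.exp (-(l * |u| ^ spinExp q)))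
      ∂(χ x : Measure ℝ)) x
  have hI : I ≠ ∞ := ne_top_of_le_ne_top ENNReal.ofReal_ne_top (hlow 0)
  -- Comparing with 1 fixes the signs of `log A` and `log α` used later.
  refine ⟨max S.toReal 1, min I.toReal 1, le_max_right _ _,
    lt_min (ENNReal.toReal_pos h2.ne' hI) one_pos, min_le_right _ _,
    fun x => ⟨hint x, hint' x, le_max_of_le_left ?_, min_le_of_left_le ?_⟩⟩
  · rw [← ENNReal.ofReal_le_iff_le_toReal h1.ne, ofReal_integral_eq_lintegral_ofReal (hint x)
      (Eventually.of_forall fun u => (Real.exp_pos _).le)]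
    exact le_iSup (fun x => ∫⁻ u, ENNReal.ofReal (Real.exp (l * |u| ^ spinExp q))
      ∂(χ x : Measure ℝ)) x
  · exact ENNReal.toReal_le_of_le_ofReal (integral_nonneg fun u => (Real.exp_pos _).le) (hlow x)

theorem SingleSpinCondition.exists_product_bounds (hχ : SingleSpinCondition q χ) {l : ℝ}
    (hl : 0 < l) :
    ∃ A α : ℝ, 1 ≤ A ∧ 0 < α ∧ α ≤ 1 ∧ ∀ Δ : Finset (Site d),
      Integrable (fun σ => Real.exp (l * ∑ x : Δ, |σ x| ^ spinExp q)) (singleSpins χ Δ) ∧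
      Integrable (fun σ => Real.exp (-(l * ∑ x : Δ, |σ x| ^ spinExp q))) (singleSpins χ Δ) ∧
      ∫ σ, Real.exp (l * ∑ x : Δ, |σ x| ^ spinExp q) ∂(singleSpins χ Δ) ≤ A ^ Δ.card ∧
      α ^ Δ.card ≤ ∫ σ, Real.exp (-(l * ∑ x : Δ, |σ x| ^ spinExp q)) ∂(singleSpins χ Δ) := by
  obtain ⟨A, α, hA, hα, hα1, h⟩ := hχ.exists_bounds hl
  refine ⟨A, α, hA, hα, hα1, fun Δ => ?_⟩
  simp only [Finset.mul_sum, ← Finset.sum_neg_distrib, Real.exp_sum]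
  refine ⟨Integrable.fintype_prod (f := fun _ u => Real.exp (l * |u| ^ spinExp q))
      fun x : Δ => (h x.1).1,
    Integrable.fintype_prod (f := fun _ u => Real.exp (-(l * |u| ^ spinExp q)))
      fun x : Δ => (h x.1).2.1, ?_, ?_⟩
  · rw [singleSpins, integral_fintype_prod_eq_prod
      (f := fun _ u => Real.exp (l * |u| ^ spinExp q)), ← Fintype.card_coe Δ,
      ← Finset.card_univ, ← Finset.prod_const]
    exact Finset.prod_le_prod (fun _ _ => integral_nonneg fun _ => (Real.exp_pos _).le)
      fun x _ => (h x.1).2.2.1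
  · rw [singleSpins, integral_fintype_prod_eq_prod
      (f := fun _ u => Real.exp (-(l * |u| ^ spinExp q))), ← Fintype.card_coe Δ,
      ← Finset.card_univ, ← Finset.prod_const]
    exact Finset.prod_le_prod (fun _ _ => hα.le) fun x _ => (h x.1).2.2.2

end SingleSpin

/-! ### Measurability of the Gibbs objects, and the DLR equation for functions. -/

section Measurability

variable {d : ℕ} {q : ℝ} {w : Weight d} [Fact (1 < q)] {α : Type*} [MeasurableSpace α]

theorem measurable_glue_apply {Δ : Finset (Site d)} {ξ : α → Config d} {σ : α → Δ → ℝ}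
    (hξ : Measurable ξ) (hσ : Measurable σ) :
    Measurable fun a => glue Δ (ξ a) (σ a) := by
  refine measurable_pi_lambda _ fun y => ?_
  simp only [glue, Function.updateFinset]
  split_ifs with h
  · exact (measurable_pi_apply _).comp hσ
  · exact (measurable_pi_apply _).comp hξ

theorem measurable_coef {J : α → Intensity q w} (hJ : ∀ e, Measurable fun a => J a e)
    (x y : Site d) : Measurable fun a => (J a).coef x y := by
  simp only [Intensity.coef]
  split_ifs with h
  · exact hJ _
  · exact measurable_const

/-- Asking only that the coordinates of `J` be measurable covers both a fixed `J` and a random one.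
-/
theorem measurable_negEnergy {Δ : Finset (Site d)} {J : α → Intensity q w} {ξ : α → Config d}
    {σ : α → Δ → ℝ} (hJ : ∀ e, Measurable fun a => J a e) (hξ : Measurable ξ)
    (hσ : Measurable σ) : Measurable fun a => negEnergy Δ (J a) (ξ a) (σ a) := by
  have hη := measurable_glue_apply hξ hσ
  refine Measurable.add (Finset.measurable_sum _ fun e _ => (hJ e).mul ?_)
    (Finset.measurable_sum _ fun x _ => Finset.measurable_sum _ fun y _ =>
      ((measurable_coef hJ _ _).mul ((measurable_pi_apply x).comp hσ)).mul
        ((measurable_pi_apply y).comp hξ))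
  obtain ⟨e, he⟩ := e
  induction e with
  | h x y =>
    simp only [Sym2.map_mk, Sym2.mul_mk]
    exact ((measurable_pi_apply x).comp hη).mul ((measurable_pi_apply y).comp hη)

variable (χ : Site d → ProbabilityMeasure ℝ)

instance (Δ : Finset (Site d)) : IsProbabilityMeasure (singleSpins χ Δ) := by
  unfold singleSpins
  infer_instance

theorem measurable_partitionFn {Δ : Finset (Site d)} {J : α → Intensity q w} {ξ : α → Config d}
    (hJ : ∀ e, Measurable fun a => J a e) (hξ : Measurable ξ) :
    Measurable fun a => partitionFn χ Δ (J a) (ξ a) := by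
  have h : Measurable fun z : α × (Δ → ℝ) => Real.exp (negEnergy Δ (J z.1) (ξ z.1) z.2) :=
    (measurable_negEnergy (fun e => (hJ e).comp measurable_fst) (hξ.comp measurable_fst)
      measurable_snd).exp
  exact (h.stronglyMeasurable.integral_prod_right' (ν := singleSpins χ Δ)).measurable

theorem measurable_pressure {Δ : Finset (Site d)} {J : α → Intensity q w} {ξ : α → Config d}
    (hJ : ∀ e, Measurable fun a => J a e) (hξ : Measurable ξ) :
    Measurable fun a => pressure χ Δ (J a) (ξ a) :=
  (measurable_partitionFn χ hJ hξ).log.const_mul _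

theorem lintegral_localGibbs (Δ : Finset (Site d)) (J : Intensity q w) (ξ : Config d)
    {F : Config d → ℝ≥0∞} (hF : Measurable F) :
    ∫⁻ η, F η ∂(localGibbs χ Δ J ξ) = ∫⁻ σ,
      ENNReal.ofReal (Real.exp (negEnergy Δ J ξ σ) / partitionFn χ Δ J ξ) * F (glue Δ ξ σ)
        ∂(singleSpins χ Δ) := by
  have hg : Measurable (glue Δ ξ) := measurable_glue_apply measurable_const measurable_id
  have he : Measurable (negEnergy Δ J ξ) :=
    measurable_negEnergy (fun _ => measurable_const) measurable_const measurable_id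
  rw [localGibbs, lintegral_map hF hg]
  exact lintegral_withDensity_eq_lintegral_mul _ (he.exp.div_const _).ennreal_ofReal (hF.comp hg)

theorem measurable_lintegral_localGibbs (Δ : Finset (Site d)) (J : Intensity q w)
    {F : Config d → Config d → ℝ≥0∞} (hF : Measurable (Function.uncurry F)) :
    Measurable fun ξ => ∫⁻ η, F ξ η ∂(localGibbs χ Δ J ξ) := by
  refine (congrArg Measurable (funext fun ξ => lintegral_localGibbs χ Δ J ξ (F := F ξ)
    (hF.comp measurable_prodMk_left))).mpr ?_
  refine Measurable.lintegral_prod_right' (ν := singleSpins χ Δ) (f := fun z : Config d × (Δ → ℝ) =>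
    ENNReal.ofReal (Real.exp (negEnergy Δ J z.1 z.2) / partitionFn χ Δ J z.1) *
      F z.1 (glue Δ z.1 z.2)) ?_
  refine Measurable.mul (Measurable.ennreal_ofReal (Measurable.div ?_ ?_)) ?_
  · exact (measurable_negEnergy (fun _ => measurable_const) measurable_fst measurable_snd).exp
  · exact (measurable_partitionFn χ (fun _ => measurable_const) measurable_id).comp measurable_fst
  · exact hF.comp (measurable_fst.prodMk (measurable_glue_apply measurable_fst measurable_snd))

theorem measurable_localGibbs (Δ : Finset (Site d)) (J : Intensity q w) :
    Measurable (localGibbs χ Δ J) := by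
  refine Measure.measurable_of_measurable_coe _ fun A hA => ?_
  have := measurable_lintegral_localGibbs χ Δ J (F := fun _ => A.indicator 1)
    ((measurable_one.indicator hA).comp measurable_snd)
  simpa only [lintegral_indicator_one hA] using this

theorem lintegral_eq_of_mem_gibbsMeasures {J : Intensity q w} {μ : ProbabilityMeasure (Config d)}
    (hμ : μ ∈ gibbsMeasures χ J) {Δ : Finset (Site d)} (hΔ : Δ.Nonempty) {F : Config d → ℝ≥0∞}
    (hF : Measurable F) :
    ∫⁻ ξ, ∫⁻ η, F η ∂(localGibbs χ Δ J ξ) ∂(μ : Measure (Config d)) =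
      ∫⁻ ξ, F ξ ∂(μ : Measure (Config d)) := by
  have hm := measurable_localGibbs χ Δ J
  have hb : (μ : Measure (Config d)).bind (localGibbs χ Δ J) = μ := by
    refine Measure.ext fun A hA => ?_
    rw [Measure.bind_apply hA hm.aemeasurable]
    exact hμ.2 Δ hΔ A hA
  rw [← Measure.lintegral_bind hm.aemeasurable hF.aemeasurable, hb]

end Measurability

/-! ### Partition functions, pressures and single-site moments. -/

section Bounds

variable {d : ℕ} {q : ℝ} {w : Weight d} [hq : Fact (1 < q)] {χ : Site d → ProbabilityMeasure ℝ}

theorem exp_negEnergy_le (Δ : Finset (Site d)) (J : Intensity q w) (ξ : Config d) (σ : Δ → ℝ) :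
    Real.exp (negEnergy Δ J ξ σ) ≤ Real.exp (∑ x ∈ Δ, siteSource J ξ x) *
      Real.exp (2 * 3 ^ d * ∑ x : Δ, |σ x| ^ spinExp q) := by
  rw [← Real.exp_add, Real.exp_le_exp]
  have := (abs_le.1 (abs_negEnergy_le Δ J ξ σ)).2
  linarith

theorem le_exp_negEnergy (Δ : Finset (Site d)) (J : Intensity q w) (ξ : Config d) (σ : Δ → ℝ) :
    Real.exp (-∑ x ∈ Δ, siteSource J ξ x) *
      Real.exp (-(2 * 3 ^ d * ∑ x : Δ, |σ x| ^ spinExp q)) ≤ Real.exp (negEnergy Δ J ξ σ) := by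
  rw [← Real.exp_add, Real.exp_le_exp]
  have := (abs_le.1 (abs_negEnergy_le Δ J ξ σ)).1
  linarith

theorem SingleSpinCondition.integrable_exp_negEnergy (hχ : SingleSpinCondition q χ)
    (Δ : Finset (Site d)) (J : Intensity q w) (ξ : Config d) :
    Integrable (fun σ => Real.exp (negEnergy Δ J ξ σ)) (singleSpins χ Δ) := by
  obtain ⟨A, α, -, -, -, h⟩ := hχ.exists_product_bounds (l := 2 * 3 ^ d) (by positivity)
  refine ((h Δ).1.const_mul (Real.exp (∑ x ∈ Δ, siteSource J ξ x))).mono'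
    (measurable_negEnergy (fun _ => measurable_const) measurable_const
      measurable_id).exp.aestronglyMeasurable (Eventually.of_forall fun σ => ?_)
  rw [Real.norm_of_nonneg (Real.exp_pos _).le]
  exact exp_negEnergy_le Δ J ξ σ

theorem SingleSpinCondition.exists_partitionFn_bounds (w : Weight d)
    (hχ : SingleSpinCondition q χ) :
    ∃ A α : ℝ, 1 ≤ A ∧ 0 < α ∧ α ≤ 1 ∧ ∀ (Δ : Finset (Site d)) (J : Intensity q w) (ξ : Config d),
      partitionFn χ Δ J ξ ≤ Real.exp (∑ x ∈ Δ, siteSource J ξ x) * A ^ Δ.card ∧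
      Real.exp (-∑ x ∈ Δ, siteSource J ξ x) * α ^ Δ.card ≤ partitionFn χ Δ J ξ := by
  obtain ⟨A, α, hA, hα, hα1, h⟩ := hχ.exists_product_bounds (l := 2 * 3 ^ d) (by positivity)
  refine ⟨A, α, hA, hα, hα1, fun Δ J ξ => ⟨?_, ?_⟩⟩
  · refine (integral_mono (hχ.integrable_exp_negEnergy Δ J ξ) ((h Δ).1.const_mul _)
      (exp_negEnergy_le Δ J ξ)).trans ?_
    rw [integral_const_mul]
    exact mul_le_mul_of_nonneg_left (h Δ).2.2.1 (Real.exp_pos _).le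
  · refine le_trans ?_ (integral_mono ((h Δ).2.1.const_mul _)
      (hχ.integrable_exp_negEnergy Δ J ξ) (le_exp_negEnergy Δ J ξ))
    rw [integral_const_mul]
    exact mul_le_mul_of_nonneg_left (h Δ).2.2.2 (Real.exp_pos _).le

theorem SingleSpinCondition.exists_abs_pressure_le (w : Weight d) (hχ : SingleSpinCondition q χ) :
    ∃ C : ℝ, ∀ (Δ : Finset (Site d)), Δ.Nonempty → ∀ (J : Intensity q w) (ξ : Config d),
      |pressure χ Δ J ξ| ≤ 1 / (Δ.card : ℝ) * ∑ x ∈ Δ, (siteSource J ξ x + C) := by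
  obtain ⟨A, α, hA, hα, hα1, h⟩ := hχ.exists_partitionFn_bounds w
  -- Since `α ≤ 1 ≤ A`, this dominates both `log A` and `-log α`.
  refine ⟨Real.log A - Real.log α, fun Δ _ J ξ => ?_⟩
  obtain ⟨hu, hl⟩ := h Δ J ξ
  have hl0 : 0 < Real.exp (-∑ x ∈ Δ, siteSource J ξ x) * α ^ Δ.card := by positivity
  have hZ : 0 < partitionFn χ Δ J ξ := hl0.trans_le hl
  have h1 := Real.log_le_log hZ hu
  have h2 := Real.log_le_log hl0 hl
  rw [Real.log_mul (Real.exp_pos _).ne' (by positivity), Real.log_exp, Real.log_pow] at h1 h2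
  rw [pressure, abs_mul, abs_of_nonneg (by positivity : (0 : ℝ) ≤ 1 / (Δ.card : ℝ))]
  refine mul_le_mul_of_nonneg_left ?_ (by positivity)
  rw [Finset.sum_add_distrib, Finset.sum_const, nsmul_eq_mul, abs_le]
  have h3 : 0 ≤ (Δ.card : ℝ) * Real.log A := mul_nonneg (by positivity) (Real.log_nonneg hA)
  have h4 : (Δ.card : ℝ) * Real.log α ≤ 0 :=
    mul_nonpos_of_nonneg_of_nonpos (by positivity) (Real.log_nonpos hα.le hα1)
  constructor <;> linarith

theorem SingleSpinCondition.isProbabilityMeasure_localGibbs (hχ : SingleSpinCondition q χ)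
    (Δ : Finset (Site d)) (J : Intensity q w) (ξ : Config d) :
    IsProbabilityMeasure (localGibbs χ Δ J ξ) := by
  obtain ⟨A, α, -, hα, -, h⟩ := hχ.exists_partitionFn_bounds w
  have hZ : 0 < partitionFn χ Δ J ξ :=
    lt_of_lt_of_le (by positivity) (h Δ J ξ).2
  refine ⟨?_⟩
  rw [← lintegral_one, lintegral_localGibbs χ Δ J ξ measurable_const]
  simp only [mul_one]
  rw [← ofReal_integral_eq_lintegral_ofReal ((hχ.integrable_exp_negEnergy Δ J ξ).div_const _)
    (Eventually.of_forall fun σ => by positivity), integral_div]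
  change ENNReal.ofReal (partitionFn χ Δ J ξ / partitionFn χ Δ J ξ) = 1
  rw [div_self hZ.ne', ENNReal.ofReal_one]

/-- The moments of the local Gibbs measure at a single site. -/
theorem SingleSpinCondition.exists_lintegral_localGibbs_singleton_le (w : Weight d)
    (hχ : SingleSpinCondition q χ) {l : ℝ} (hl : 0 < l) :
    ∃ C : ℝ, 0 ≤ C ∧ ∀ (x : Site d) (J : Intensity q w) (ξ : Config d),
      ∫⁻ η, ENNReal.ofReal (l * |η x| ^ spinExp q) ∂(localGibbs χ {x} J ξ) ≤
        ENNReal.ofReal (2 * siteSource J ξ x + C) := by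
  obtain ⟨_, α, -, hα, hα1, hZ⟩ := hχ.exists_partitionFn_bounds w
  obtain ⟨A, _, hA, -, -, hA2⟩ := hχ.exists_product_bounds (l := 2 * 3 ^ d + l) (by positivity)
  have hlog : 0 ≤ Real.log (A / α) := Real.log_nonneg ((one_le_div hα).2 (hα1.trans hA))
  refine ⟨Real.log (A / α) + 1, by positivity, fun x J ξ => ?_⟩
  have hQ := siteSource_nonneg J ξ x
  set Q := siteSource J ξ x
  -- The Gibbs density is at most `exp (2 Q) α⁻¹ exp (2 * 3 ^ d * t)`, so with this `s` the integral
  -- of `exp (l t - s)` against it is at most 1. The coefficient of `Q` does not depend on `l`; the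
  -- contraction argument relies on this.
  set s := 2 * Q + Real.log (A / α)
  obtain ⟨hint, -, hIA, -⟩ := hA2 {x}
  have hl' := (hZ {x} J ξ).2
  rw [Finset.sum_singleton, Finset.card_singleton, pow_one] at hl'
  rw [Finset.card_singleton, pow_one] at hIA
  set Z := partitionFn χ {x} J ξ
  have hZ0 : 0 < Z := lt_of_lt_of_le (by positivity) hl'
  have hm : Measurable fun η : Config d => ENNReal.ofReal (l * |η x| ^ spinExp q) :=
    (((measurable_abs_rpow _).comp (measurable_pi_apply x)).const_mul l).ennreal_ofReal
  rw [lintegral_localGibbs χ {x} J ξ hm]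
  have hE := hχ.integrable_exp_negEnergy {x} J ξ
  let g : (({x} : Finset (Site d)) → ℝ) → ℝ := fun σ =>
    s * (Real.exp (negEnergy {x} J ξ σ) / Z) +
      α / A * α⁻¹ * Real.exp ((2 * 3 ^ d + l) * ∑ y : ({x} : Finset (Site d)), |σ y| ^ spinExp q)
  have hg : Integrable g (singleSpins χ {x}) :=
    ((hE.div_const Z).const_mul s).add (hint.const_mul _)
  have hgI : ∫ σ, g σ ∂(singleSpins χ {x}) ≤ s + 1 := by
    rw [integral_add ((hE.div_const Z).const_mul s) (hint.const_mul _), integral_const_mul,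
      integral_div, integral_const_mul]
    have e1 : ∫ σ, Real.exp (negEnergy {x} J ξ σ) ∂(singleSpins χ {x}) = Z := rfl
    rw [e1, div_self hZ0.ne', mul_one]
    refine add_le_add le_rfl ?_
    calc _ ≤ α / A * α⁻¹ * A := mul_le_mul_of_nonneg_left hIA (by positivity)
      _ = 1 := by field_simp
  have hpt : ∀ σ : (({x} : Finset (Site d)) → ℝ),
      ENNReal.ofReal (Real.exp (negEnergy {x} J ξ σ) / Z) *
        ENNReal.ofReal (l * |glue {x} ξ σ x| ^ spinExp q) ≤ ENNReal.ofReal (g σ) := by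
    intro σ
    rw [← ENNReal.ofReal_mul (by positivity)]
    refine ENNReal.ofReal_le_ofReal ?_
    have hx : glue {x} ξ σ x = σ ⟨x, Finset.mem_singleton_self x⟩ := by
      simp [glue, Function.updateFinset]
    have hsum : ∑ y : ({x} : Finset (Site d)), |σ y| ^ spinExp q =
        |σ ⟨x, Finset.mem_singleton_self x⟩| ^ spinExp q := by
      rw [Fintype.sum_eq_single ⟨x, Finset.mem_singleton_self x⟩]
      rintro ⟨y, hy⟩ hne
      exact absurd (Subtype.ext (Finset.mem_singleton.1 hy)) hne
    have hup := exp_negEnergy_le {x} J ξ σ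
    rw [Finset.sum_singleton, hsum] at hup
    simp only [g]
    rw [hx, hsum]
    set t := |σ ⟨x, Finset.mem_singleton_self x⟩| ^ spinExp q
    set E := Real.exp (negEnergy {x} J ξ σ)
    have hE0 : 0 < E := Real.exp_pos _
    -- A moment is traded for an exponential moment through `1 + u ≤ exp u`.
    have h1 : l * t ≤ s + Real.exp (l * t - s) := by
      have := Real.add_one_le_exp (l * t - s)
      linarith
    have h2 : E / Z ≤ Real.exp (2 * Q) * Real.exp (2 * 3 ^ d * t) * α⁻¹ := by
      rw [div_le_iff₀ hZ0]
      calc E ≤ Real.exp Q * Real.exp (2 * 3 ^ d * t) := hup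
        _ = Real.exp (2 * Q) * Real.exp (2 * 3 ^ d * t) * α⁻¹ * (Real.exp (-Q) * α) := by
            rw [two_mul Q, Real.exp_add, Real.exp_neg]
            field_simp
        _ ≤ _ := mul_le_mul_of_nonneg_left hl' (by positivity)
    calc E / Z * (l * t) ≤ E / Z * (s + Real.exp (l * t - s)) :=
          mul_le_mul_of_nonneg_left h1 (by positivity)
      _ = s * (E / Z) + E / Z * Real.exp (l * t - s) := by ring
      _ ≤ s * (E / Z) +
          Real.exp (2 * Q) * Real.exp (2 * 3 ^ d * t) * α⁻¹ * Real.exp (l * t - s) := by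
          gcongr
      _ = _ := by
          have e2 : Real.exp (l * t - s) = Real.exp (l * t) * (Real.exp (2 * Q))⁻¹ * (α / A) := by
            rw [Real.exp_sub, Real.exp_add, Real.exp_log (by positivity)]
            field_simp
          rw [e2, add_mul (2 * 3 ^ d) l t, Real.exp_add (2 * 3 ^ d * t)]
          field_simp
  calc _ ≤ ∫⁻ σ, ENNReal.ofReal (g σ) ∂(singleSpins χ {x}) := lintegral_mono hpt
    _ = ENNReal.ofReal (∫ σ, g σ ∂(singleSpins χ {x})) :=
        (ofReal_integral_eq_lintegral_ofReal hg (Eventually.of_forall fun σ => by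
          have : 0 ≤ s := by positivity
          positivity)).symm
    _ ≤ _ := ENNReal.ofReal_le_ofReal (by linarith)

end Bounds

/-! ### The damping of the weighted sum. -/

section Tempered

variable {d : ℕ} (q : ℝ) (w : Weight d)

/-- The weighted sum `∑ₓ |σ x|^p w x`, valued in `[0, ∞]`. -/
def temperedSum (σ : Config d) : ℝ≥0∞ := ∑' x, ENNReal.ofReal (|σ x| ^ spinExp q * w x)

/-- The derivative `(1 + ε v)⁻²` of the concave function `v / (1 + ε v)`, at `v = ∑ₓ |σ x|^p w x`. -/
def damping (ε : ℝ) (σ : Config d) : ℝ := 1 / (1 + ε * (temperedSum q w σ).toReal) ^ 2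

theorem measurable_temperedSum : Measurable (temperedSum q w) :=
  Measurable.tsum fun x =>
    (((measurable_abs_rpow _).comp (measurable_pi_apply x)).mul_const _).ennreal_ofReal

theorem measurable_damping (ε : ℝ) : Measurable (damping q w ε) :=
  ((((measurable_temperedSum q w).ennreal_toReal.const_mul ε).const_add 1).pow_const 2).const_div 1

variable {q w}

theorem damping_nonneg (ε : ℝ) (σ : Config d) : 0 ≤ damping q w ε σ := by
  unfold damping
  positivity

theorem damping_le_one {ε : ℝ} (hε : 0 ≤ ε) (σ : Config d) : damping q w ε σ ≤ 1 := by
  unfold damping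
  rw [div_le_one (by positivity)]
  exact one_le_pow₀ (le_add_of_nonneg_right (by positivity))

theorem temperedSum_ne_top {σ : Config d} (hσ : σ ∈ temperedConfig q w) :
    temperedSum q w σ ≠ ∞ := by
  rw [temperedSum, ← ENNReal.ofReal_tsum_of_nonneg (fun x => mul_nonneg (by positivity) (w.pos x).le)
    hσ]
  exact ENNReal.ofReal_ne_top

/-- Only the term at `x` changes. The form without subtraction remains valid when the sums are
infinite. -/
theorem temperedSum_glue_singleton (x : Site d) (ξ : Config d)
    (σ : ({x} : Finset (Site d)) → ℝ) :
    temperedSum q w (glue {x} ξ σ) + ENNReal.ofReal (|ξ x| ^ spinExp q * w x) =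
      temperedSum q w ξ + ENNReal.ofReal (|glue {x} ξ σ x| ^ spinExp q * w x) := by
  have hoff : ∀ y, y ≠ x → glue {x} ξ σ y = ξ y := fun y hy => by
    simp [glue, Function.updateFinset, hy]
  rw [temperedSum, temperedSum, ENNReal.tsum_eq_add_tsum_ite x,
    ENNReal.tsum_eq_add_tsum_ite (f := fun y => ENNReal.ofReal (|ξ y| ^ spinExp q * w y)) x]
  have hadd : ∀ a b S T : ℝ≥0∞, S = T → a + S + b = b + T + a := fun a b S T h => by
    rw [h]
    ring
  refine hadd _ _ _ _ (tsum_congr fun y => ?_)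
  split_ifs with h
  · rfl
  · rw [hoff y h]

/-- Here `|σ x|^p ≤ v / w x` and `ε v ≤ (1 + ε v)²`. This is the a priori finiteness, with growth `1
/ w`, that the recursion for the damped moments starts from. -/
theorem damping_mul_le {ε : ℝ} (hε : 0 < ε) {σ : Config d} (hσ : σ ∈ temperedConfig q w)
    (x : Site d) : damping q w ε σ * |σ x| ^ spinExp q ≤ (1 / ε) / w x := by
  have hle : ENNReal.ofReal (|σ x| ^ spinExp q * w x) ≤ temperedSum q w σ :=
    ENNReal.le_tsum (f := fun x => ENNReal.ofReal (|σ x| ^ spinExp q * w x)) x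
  have ht := (ENNReal.ofReal_le_iff_le_toReal (temperedSum_ne_top hσ)).1 hle
  unfold damping
  set v := (temperedSum q w σ).toReal
  have hv : 0 ≤ v := ENNReal.toReal_nonneg
  rw [le_div_iff₀ (w.pos x), mul_assoc, one_div_mul_eq_div, div_le_div_iff₀ (by positivity) hε]
  nlinarith [mul_nonneg hε.le hv, sq_nonneg (ε * v)]

/-- The tangent-line inequality `f v' ≤ f v + f' v (v' - v)` for the concave `f v = v / (1 + ε v)`,
with `v' - v = t' - t`. -/
theorem div_one_add_mul_add_le {ε v v' t t' : ℝ} (hε : 0 < ε) (hv : 0 ≤ v) (hv' : 0 ≤ v')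
    (h : v' + t = v + t') :
    v' / (1 + ε * v') + 1 / (1 + ε * v) ^ 2 * t ≤ v / (1 + ε * v) + 1 / (1 + ε * v) ^ 2 * t' := by
  have ha : 0 < 1 + ε * v := by positivity
  have hb : 0 < 1 + ε * v' := by positivity
  have e : t = t' + v - v' := by linarith
  have : v / (1 + ε * v) + 1 / (1 + ε * v) ^ 2 * t' -
      (v' / (1 + ε * v') + 1 / (1 + ε * v) ^ 2 * t) =
      ε * (v' - v) ^ 2 / ((1 + ε * v) ^ 2 * (1 + ε * v')) := by
    rw [e]
    field_simp
    ring
  have : 0 ≤ ε * (v' - v) ^ 2 / ((1 + ε * v) ^ 2 * (1 + ε * v')) := by positivity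
  linarith

end Tempered

/-! ### Damped moments of Gibbs measures. -/

section Moments

variable {d : ℕ} {q : ℝ} {w : Weight d} [hq : Fact (1 < q)] {χ : Site d → ProbabilityMeasure ℝ}

theorem lintegral_localGibbs_mono (χ : Site d → ProbabilityMeasure ℝ) {Δ : Finset (Site d)}
    {J : Intensity q w} {ξ : Config d}
    {F G : Config d → ℝ≥0∞} (hF : Measurable F) (hG : Measurable G)
    (h : ∀ σ, F (glue Δ ξ σ) ≤ G (glue Δ ξ σ)) :
    ∫⁻ η, F η ∂(localGibbs χ Δ J ξ) ≤ ∫⁻ η, G η ∂(localGibbs χ Δ J ξ) := by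
  rw [lintegral_localGibbs χ Δ J ξ hF, lintegral_localGibbs χ Δ J ξ hG]
  exact lintegral_mono fun σ => mul_le_mul_right (h σ) _

theorem measurable_siteSource {α : Type*} [MeasurableSpace α] {J : α → Intensity q w}
    {ξ : α → Config d} (hJ : ∀ e, Measurable fun a => J a e) (hξ : Measurable ξ) (x : Site d) :
    Measurable fun a => siteSource (J a) (ξ a) x :=
  Finset.measurable_sum _ fun y _ =>
    ((measurable_abs_rpow q).comp (measurable_coef hJ x y)).add
      ((measurable_abs_rpow _).comp ((measurable_pi_apply y).comp hξ))

theorem ae_mem_temperedConfig {J : Intensity q w} {μ : ProbabilityMeasure (Config d)}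
    (hμ : μ ∈ gibbsMeasures χ J) :
    ∀ᵐ ξ ∂(μ : Measure (Config d)), ξ ∈ temperedConfig q w := by
  have hset : temperedConfig q w = {σ : Config d | temperedSum q w σ < ∞} := by
    ext σ
    refine ⟨fun h => (temperedSum_ne_top h).lt_top, fun h => ?_⟩
    have := ENNReal.summable_toReal (LT.lt.ne h)
    refine this.congr fun x => ENNReal.toReal_ofReal (mul_nonneg (by positivity) (w.pos x).le)
  have hmeas : MeasurableSet (temperedConfig q w) := by
    rw [hset]
    exact measurableSet_lt (measurable_temperedSum q w) measurable_const
  exact (prob_compl_eq_zero_iff hmeas).2 hμ.1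

/-- The damping depends on the spin at `x`, so the DLR equation cannot be applied directly to the
damped moment. It is applied instead to a multiple `h` of the bounded function `f(v)`: resampling
the spin at `x` and using concavity, then integrating, leaves `∫ h` on both sides. Once it cancels,
the damping is evaluated at the old configuration `ξ` on both sides. -/
theorem lintegral_damping_mul_le (hχ : SingleSpinCondition q χ) {l C : ℝ} (hl : 0 < l)
    {x : Site d} {J : Intensity q w}
    (hC : ∀ ξ : Config d, ∫⁻ η, ENNReal.ofReal (l * |η x| ^ spinExp q) ∂(localGibbs χ {x} J ξ) ≤
        ENNReal.ofReal (2 * siteSource J ξ x + C))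
    {μ : ProbabilityMeasure (Config d)} (hμ : μ ∈ gibbsMeasures χ J) {ε : ℝ} (hε : 0 < ε) :
    ENNReal.ofReal l * ∫⁻ ξ, ENNReal.ofReal (damping q w ε ξ * |ξ x| ^ spinExp q) ∂(μ : Measure _) ≤
      ∫⁻ ξ, ENNReal.ofReal (damping q w ε ξ * (2 * siteSource J ξ x + C)) ∂(μ : Measure _) := by
  have hwx := w.pos x
  let V : Config d → ℝ := fun σ => (temperedSum q w σ).toReal
  have hV0 : ∀ σ, 0 ≤ V σ := fun σ => ENNReal.toReal_nonneg
  have hV : Measurable V := (measurable_temperedSum q w).ennreal_toReal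
  let h : Config d → ℝ≥0∞ := fun σ => ENNReal.ofReal (l / w x * (V σ / (1 + ε * V σ)))
  have hh : Measurable h :=
    ((hV.div ((hV.const_mul ε).const_add 1)).const_mul _).ennreal_ofReal
  -- Finiteness of `∫ h` licenses the cancellation in `[0, ∞]`; it holds because `f ≤ 1 / ε`.
  have hfin : ∫⁻ ξ, h ξ ∂(μ : Measure (Config d)) ≠ ∞ := by
    refine ne_top_of_le_ne_top (b := ∫⁻ _, ENNReal.ofReal (l / w x * (1 / ε))
      ∂(μ : Measure (Config d))) (by simp) (lintegral_mono fun σ => ?_)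
    refine ENNReal.ofReal_le_ofReal (mul_le_mul_of_nonneg_left ?_ (by positivity))
    have := hV0 σ
    rw [div_le_div_iff₀ (by positivity) hε]
    nlinarith
  have hp : Measurable fun η : Config d => |η x| ^ spinExp q :=
    (measurable_abs_rpow _).comp (measurable_pi_apply x)
  have hdp : Measurable fun η : Config d =>
      ENNReal.ofReal (damping q w ε η * (l * |η x| ^ spinExp q)) :=
    ((measurable_damping q w ε).mul (hp.const_mul l)).ennreal_ofReal
  have hloc : ∀ᵐ ξ ∂(μ : Measure (Config d)),
      ∫⁻ η, h η ∂(localGibbs χ {x} J ξ) +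
        ENNReal.ofReal (damping q w ε ξ * (l * |ξ x| ^ spinExp q)) ≤
      h ξ + ENNReal.ofReal (damping q w ε ξ * (2 * siteSource J ξ x + C)) := by
    filter_upwards [ae_mem_temperedConfig hμ] with ξ hξ
    have := hχ.isProbabilityMeasure_localGibbs {x} J ξ
    have hm2 : Measurable fun η : Config d =>
        ENNReal.ofReal (damping q w ε ξ) * ENNReal.ofReal (l * |η x| ^ spinExp q) :=
      (hp.const_mul l).ennreal_ofReal.const_mul _
    have hmono := lintegral_localGibbs_mono χ (Δ := {x}) (J := J) (ξ := ξ)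
      (F := fun η => h η + ENNReal.ofReal (damping q w ε ξ * (l * |ξ x| ^ spinExp q)))
      (G := fun η => h ξ + ENNReal.ofReal (damping q w ε ξ) *
        ENNReal.ofReal (l * |η x| ^ spinExp q)) (hh.add_const _) (hm2.const_add _) (fun σ => by
          have hξV := temperedSum_ne_top hξ
          have heq := temperedSum_glue_singleton (q := q) (w := w) x ξ σ
          set η := glue {x} ξ σ
          have hηV : temperedSum q w η ≠ ∞ := by
            have : temperedSum q w η + ENNReal.ofReal (|ξ x| ^ spinExp q * w x) ≠ ∞ := by
              rw [heq]
              exact ENNReal.add_ne_top.2 ⟨hξV, ENNReal.ofReal_ne_top⟩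
            exact (ENNReal.add_ne_top.1 this).1
          have hreal : V η + |ξ x| ^ spinExp q * w x = V ξ + |η x| ^ spinExp q * w x := by
            have := congrArg ENNReal.toReal heq
            rwa [ENNReal.toReal_add hηV ENNReal.ofReal_ne_top,
              ENNReal.toReal_add hξV ENNReal.ofReal_ne_top, ENNReal.toReal_ofReal (by positivity),
              ENNReal.toReal_ofReal (by positivity)] at this
          have hc := div_one_add_mul_add_le hε (hV0 ξ) (hV0 η) hreal
          have hη0 := hV0 η
          have hξ0 := hV0 ξ
          have hd0 := damping_nonneg (q := q) (w := w) ε ξ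
          dsimp only [h]
          rw [← ENNReal.ofReal_mul hd0, ← ENNReal.ofReal_add (by positivity) (by positivity),
            ← ENNReal.ofReal_add (by positivity) (by positivity)]
          refine ENNReal.ofReal_le_ofReal ?_
          have hc2 := mul_le_mul_of_nonneg_left hc (by positivity : 0 ≤ l / w x)
          have e1 : l / w x * (V η / (1 + ε * V η) + 1 / (1 + ε * V ξ) ^ 2 *
              (|ξ x| ^ spinExp q * w x)) = l / w x * (V η / (1 + ε * V η)) +
              damping q w ε ξ * (l * |ξ x| ^ spinExp q) := by
            simp only [damping, V]
            field_simp
          have e2 : l / w x * (V ξ / (1 + ε * V ξ) + 1 / (1 + ε * V ξ) ^ 2 *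
              (|η x| ^ spinExp q * w x)) = l / w x * (V ξ / (1 + ε * V ξ)) +
              damping q w ε ξ * (l * |η x| ^ spinExp q) := by
            simp only [damping, V]
            field_simp
          rwa [e1, e2] at hc2)
    rw [lintegral_add_left hh, lintegral_add_left measurable_const, lintegral_const, lintegral_const,
      measure_univ, mul_one, mul_one, lintegral_const_mul _ (hp.const_mul l).ennreal_ofReal] at hmono
    refine hmono.trans (add_le_add le_rfl ?_)
    rw [ENNReal.ofReal_mul (damping_nonneg ε ξ)]
    exact mul_le_mul_right (hC ξ) _
  have hint := lintegral_mono_ae hloc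
  rw [lintegral_add_right _ hdp, lintegral_add_left hh,
    lintegral_eq_of_mem_gibbsMeasures χ hμ (Finset.singleton_nonempty x) hh,
    ENNReal.add_le_add_iff_left hfin] at hint
  have hdp' : Measurable fun η : Config d => ENNReal.ofReal (damping q w ε η * |η x| ^ spinExp q) :=
    ((measurable_damping q w ε).mul hp).ennreal_ofReal
  rw [← lintegral_const_mul _ hdp']
  refine le_trans (le_of_eq (lintegral_congr fun ξ => ?_)) hint
  rw [← ENNReal.ofReal_mul hl.le]
  congr 1
  ring

/-- A bound for solutions of a subharmonicity inequality that grow at most like `1 / w`. -/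
theorem le_of_mul_le_add_sum_nbrs {a : Site d → ℝ} {w₀ B M l : ℝ} (hw₀ : 0 < w₀)
    (hw : ∀ x y, (lattice d).Adj x y → w x ≤ w₀ * w y) (hM : 0 ≤ M)
    (hB : 0 ≤ B) (hl : 4 * 3 ^ d * (1 + w₀) ≤ l)
    (h : ∀ x, l * a x ≤ B + 2 * ∑ y ∈ nbrs x, a y) (ha : ∀ x, a x ≤ M / w x) (x : Site d) :
    a x ≤ 2 * B / l := by
  have hD : (0 : ℝ) < 3 ^ d := by positivity
  have hl0 : 0 < l := lt_of_lt_of_le (by positivity) hl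
  -- Passing to a neighbour costs a factor `w₀` in `M / w`, and the lower bound on `l` absorbs it:
  -- each use of the inequality halves the excess over `2 * B / l`.
  have key : ∀ (k : ℕ) x, a x ≤ 2 * B / l + M / w x * (1 / 2) ^ k := by
    intro k
    induction k with
    | zero =>
      intro x
      have : 0 ≤ 2 * B / l := by positivity
      simpa using (ha x).trans (by linarith)
    | succ k ih =>
      intro x
      have hwx := w.pos x
      have hb : ∀ y ∈ nbrs x, a y ≤ 2 * B / l + w₀ * (M / w x) * (1 / 2) ^ k := by
        intro y hy
        refine (ih y).trans (add_le_add le_rfl (mul_le_mul_of_nonneg_right ?_ (by positivity)))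
        have hwy := w.pos y
        rw [← mul_div_assoc, div_le_div_iff₀ hwy hwx]
        calc M * w x ≤ M * (w₀ * w y) := mul_le_mul_of_nonneg_left (hw x y ((mem_nbrs x y).1 hy)) hM
          _ = w₀ * M * w y := by ring
      have hs := Finset.sum_le_sum hb
      rw [Finset.sum_const, nsmul_eq_mul] at hs
      set u := M / w x * (1 / 2) ^ k with hu
      have hu0 : 0 ≤ u := by positivity
      have e : w₀ * (M / w x) * (1 / 2) ^ k = w₀ * u := by rw [hu]; ring
      rw [e] at hs
      set v := 2 * B / l with hv
      have hv0 : 0 ≤ v := by positivity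
      have hlv : l * v = 2 * B := by rw [hv]; field_simp
      have hs2 := hs.trans (mul_le_mul_of_nonneg_right (card_nbrs_le x) (by positivity))
      have hx := h x
      have h1 : 4 * 3 ^ d * v ≤ l * v :=
        mul_le_mul_of_nonneg_right (le_trans (by nlinarith) hl) hv0
      have h2 : 4 * 3 ^ d * w₀ * u ≤ l * u :=
        mul_le_mul_of_nonneg_right (le_trans (by nlinarith) hl) hu0
      have e2 : M / w x * (1 / 2) ^ (k + 1) = u / 2 := by rw [hu, pow_succ]; ring
      rw [e2]
      refine le_of_mul_le_mul_left ?_ hl0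
      nlinarith
  have hlim : Tendsto (fun k : ℕ => 2 * B / l + M / w x * (1 / 2 : ℝ) ^ k) atTop
      (𝓝 (2 * B / l + M / w x * 0)) :=
    ((tendsto_pow_atTop_nhds_zero_of_lt_one (by norm_num) (by norm_num)).const_mul _).const_add _
  rw [mul_zero, add_zero] at hlim
  exact ge_of_tendsto' hlim fun k => key k x

end Moments

end RandomSpin

/-- By the portmanteau theorem the mass of an open set is lower semicontinuous in the measure, and
open sets form a π-system generating the Borel sets. -/
theorem MeasureTheory.measurable_toMeasure_of_measurable_borel {Ω β : Type*} [MeasurableSpace Ω]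
    [TopologicalSpace β] [MeasurableSpace β] [BorelSpace β] [HasOuterApproxClosed β]
    {μ : Ω → ProbabilityMeasure β}
    (hμ : Measurable[_, borel (ProbabilityMeasure β)] μ) :
    Measurable fun ω => (μ ω : Measure β) := by
  refine Measurable.measure_of_isPiSystem_of_isProbabilityMeasure
    (S := {s : Set β | IsOpen s}) BorelSpace.measurable_eq isPiSystem_isOpen fun G hG => ?_
  have hlsc : LowerSemicontinuous fun P : ProbabilityMeasure β => (P : Measure β) G :=
    lowerSemicontinuous_iff_le_liminf.2 fun P =>
      ProbabilityMeasure.le_liminf_measure_open_of_tendsto tendsto_id hG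
  refine measurable_of_Ioi fun c => ?_
  exact hμ (MeasurableSpace.measurableSet_generateFrom (hlsc.isOpen_preimage c))

theorem MeasureTheory.integrable_and_integral_abs_le_of_lintegral_le {Ω : Type*} [MeasurableSpace Ω]
    {P : Measure Ω} {f : Ω → ℝ} (hf : AEStronglyMeasurable f P) {B : ℝ≥0∞} (hB : B ≠ ∞)
    (h : ∫⁻ ω, ENNReal.ofReal |f ω| ∂P ≤ B) : Integrable f P ∧ ∫ ω, |f ω| ∂P ≤ B.toReal := by
  constructor
  · refine ⟨hf, ?_⟩
    rw [hasFiniteIntegral_iff_norm]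
    exact h.trans_lt hB.lt_top
  · rw [integral_eq_lintegral_of_nonneg_ae (Eventually.of_forall fun _ => abs_nonneg _) hf.norm]
    exact ENNReal.toReal_mono hB h

namespace RandomSpin

/-! ### Coordinates of the intensities. -/

section Intensity

variable {d : ℕ} {q : ℝ} {w : Weight d} [hq : Fact (1 < q)]

theorem abs_apply_mul_le_norm (J : Intensity q w) (e : Edge d) :
    |J e| * w.edge e ^ (1 / q) ≤ ‖J‖ := by
  have hq0 : 0 < q := by linarith [hq.out]
  have hw := (w.edge_pos e).le
  have h1 : |J e| ^ q * w.edge e ≤ ∑' e, |J e| ^ q * w.edge e :=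
    J.2.le_tsum e fun e _ => mul_nonneg (by positivity) (w.edge_pos e).le
  have h2 : ‖J‖ = (∑' e, |J e| ^ q * w.edge e) ^ (1 / q) := rfl
  rw [h2, ← Real.rpow_le_rpow_iff (by positivity) (Real.rpow_nonneg (le_trans (by positivity) h1) _)
    hq0, intensity_rpow hq0, ← Real.rpow_mul (le_trans (by positivity) h1),
    one_div_mul_cancel hq0.ne', Real.rpow_one]
  exact h1

/-- The weight of an edge is positive, so a coordinate is Lipschitz for the norm; hence it is
measurable for every σ-field containing the Borel sets. -/
theorem continuous_apply_edge (e : Edge d) : Continuous fun J : Intensity q w => J e := by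
  have hw : 0 < w.edge e ^ (1 / q) := Real.rpow_pos_of_pos (w.edge_pos e) _
  refine (LipschitzWith.of_dist_le' (K := (w.edge e ^ (1 / q))⁻¹) fun J K => ?_).continuous
  have h : dist J K = ‖J - K‖ := dist_eq_norm J K
  rw [h, inv_mul_eq_div, le_div_iff₀ hw]
  exact abs_apply_mul_le_norm (J - K) e

theorem measurable_apply_edge [MeasurableSpace (Intensity q w)] [OpensMeasurableSpace (Intensity q w)]
    (e : Edge d) : Measurable fun J : Intensity q w => J e :=
  (continuous_apply_edge e).measurable

end Intensity

/-! ### Moment and pressure bounds under the joint law. -/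

section JointLaw

variable {d : ℕ} {q : ℝ} {w : Weight d} [hq : Fact (1 < q)] [MeasurableSpace (Intensity q w)]
  {ν : Measure (Intensity q w)} {μ : Intensity q w → ProbabilityMeasure (Config d)}

/-- A measurable family of probability measures, as a kernel. -/
def gibbsKernel (hμ : Measurable fun J => (μ J : Measure (Config d))) :
    ProbabilityTheory.Kernel (Intensity q w) (Config d) :=
  ⟨fun J => (μ J : Measure (Config d)), hμ⟩

instance (hμ : Measurable fun J => (μ J : Measure (Config d))) :
    ProbabilityTheory.IsMarkovKernel (gibbsKernel hμ) :=
  ⟨fun J => inferInstanceAs (IsProbabilityMeasure (μ J : Measure (Config d)))⟩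

theorem measurable_lintegral_gibbs (hμ : Measurable fun J => (μ J : Measure (Config d)))
    {F : Config d × Intensity q w → ℝ≥0∞} (hF : Measurable F) :
    Measurable fun J => ∫⁻ ξ, F (ξ, J) ∂(μ J : Measure (Config d)) :=
  Measurable.lintegral_kernel_prod_right' (κ := gibbsKernel hμ) (hF.comp measurable_swap)

theorem measurable_map_prodMk (hμ : Measurable fun J => (μ J : Measure (Config d))) :
    Measurable fun J => (μ J : Measure (Config d)).map fun σ => (σ, J) := by
  refine Measure.measurable_of_measurable_coe _ fun s hs => ?_
  have := measurable_lintegral_gibbs hμ (measurable_one.indicator hs)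
  refine (congrArg Measurable (funext fun J => ?_)).mpr this
  rw [← lintegral_indicator_one hs,
    lintegral_map (measurable_one.indicator hs) measurable_prodMk_right]

theorem lintegral_jointLaw (hμ : Measurable fun J => (μ J : Measure (Config d)))
    {F : Config d × Intensity q w → ℝ≥0∞} (hF : Measurable F) :
    ∫⁻ z, F z ∂(jointLaw ν μ) = ∫⁻ J, ∫⁻ ξ, F (ξ, J) ∂(μ J : Measure (Config d)) ∂ν := by
  rw [jointLaw, Measure.lintegral_bind (measurable_map_prodMk hμ).aemeasurable hF.aemeasurable]
  exact lintegral_congr fun J => lintegral_map hF measurable_prodMk_right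

theorem isProbabilityMeasure_jointLaw [IsProbabilityMeasure ν]
    (hμ : Measurable fun J => (μ J : Measure (Config d))) :
    IsProbabilityMeasure (jointLaw ν μ) := by
  refine ⟨?_⟩
  rw [← lintegral_one, lintegral_jointLaw hμ measurable_const]
  simp

theorem measurable_spin_rpow (x : Site d) :
    Measurable fun z : Config d × Intensity q w => |z.1 x| ^ spinExp q :=
  (measurable_abs_rpow _).comp ((measurable_pi_apply x).comp measurable_fst)

variable [OpensMeasurableSpace (Intensity q w)]

theorem lintegral_coef_le (hμ : Measurable fun J => (μ J : Measure (Config d)))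
    {x y : Site d} (hxy : (lattice d).Adj x y) :
    ∫⁻ z, ENNReal.ofReal (|z.2.coef x y| ^ q) ∂(jointLaw ν μ) ≤
      ⨆ e : Edge d, ∫⁻ J, ENNReal.ofReal (|J e| ^ q) ∂ν := by
  have hm : Measurable fun z : Config d × Intensity q w => ENNReal.ofReal (|z.2.coef x y| ^ q) :=
    ((measurable_abs_rpow q).comp (measurable_coef
      (fun e => (measurable_apply_edge e).comp measurable_snd) x y)).ennreal_ofReal
  rw [lintegral_jointLaw hμ hm]
  simp only [lintegral_const, measure_univ, mul_one, Intensity.coef, dif_pos hxy]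
  exact le_iSup (fun e : Edge d => ∫⁻ J, ENNReal.ofReal (|J e| ^ q) ∂ν) ⟨s(x, y), hxy⟩

variable [IsProbabilityMeasure ν] {χ : Site d → ProbabilityMeasure ℝ}

/-- The damping is dropped on the couplings, where `D ≤ 1` suffices, and kept on the spins, so that
the right side involves the same damped moments and the recursion closes. The choice `D = 1` serves
for the pressures. -/
theorem lintegral_damped_source_le (hμ : Measurable fun J => (μ J : Measure (Config d)))
    {D : Config d → ℝ} (hD : Measurable D) (hD0 : ∀ ξ, 0 ≤ D ξ) (hD1 : ∀ ξ, D ξ ≤ 1) {C : ℝ}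
    (x : Site d) :
    ∫⁻ z, ENNReal.ofReal (D z.1 * (2 * siteSource z.2 z.1 x + C)) ∂(jointLaw ν μ) ≤
      ENNReal.ofReal |C| + ∑ y ∈ nbrs x, 2 * ((⨆ e : Edge d, ∫⁻ J, ENNReal.ofReal (|J e| ^ q) ∂ν) +
        ∫⁻ z, ENNReal.ofReal (D z.1 * |z.1 y| ^ spinExp q) ∂(jointLaw ν μ)) := by
  have := isProbabilityMeasure_jointLaw (ν := ν) hμ
  have hmJ : ∀ y, Measurable fun z : Config d × Intensity q w =>
      ENNReal.ofReal (|z.2.coef x y| ^ q) := fun y =>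
    ((measurable_abs_rpow q).comp (measurable_coef
      (fun e => (measurable_apply_edge e).comp measurable_snd) x y)).ennreal_ofReal
  have hms : ∀ y, Measurable fun z : Config d × Intensity q w =>
      ENNReal.ofReal (D z.1 * |z.1 y| ^ spinExp q) := fun y =>
    ((hD.comp measurable_fst).mul (measurable_spin_rpow y)).ennreal_ofReal
  have hmsum : ∀ y, Measurable fun z : Config d × Intensity q w =>
      ENNReal.ofReal (|z.2.coef x y| ^ q) + ENNReal.ofReal (D z.1 * |z.1 y| ^ spinExp q) :=
    fun y => (hmJ y).add (hms y)
  calc _ ≤ ∫⁻ z, (ENNReal.ofReal |C| + ∑ y ∈ nbrs x, 2 * (ENNReal.ofReal (|z.2.coef x y| ^ q) +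
        ENNReal.ofReal (D z.1 * |z.1 y| ^ spinExp q))) ∂(jointLaw ν μ) := by
        refine lintegral_mono fun z => ?_
        have h0 := hD0 z.1
        have h1 := hD1 z.1
        have hterm : ∀ y, 2 * (ENNReal.ofReal (|z.2.coef x y| ^ q) +
            ENNReal.ofReal (D z.1 * |z.1 y| ^ spinExp q)) =
            ENNReal.ofReal (2 * (|z.2.coef x y| ^ q + D z.1 * |z.1 y| ^ spinExp q)) := fun y => by
          rw [← ENNReal.ofReal_add (by positivity) (by positivity),
            ENNReal.ofReal_mul zero_le_two, ENNReal.ofReal_ofNat]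
        simp only [hterm]
        rw [← ENNReal.ofReal_sum_of_nonneg fun y _ => by positivity,
          ← ENNReal.ofReal_add (abs_nonneg C) (Finset.sum_nonneg fun y _ => by positivity)]
        refine ENNReal.ofReal_le_ofReal ?_
        have hC : D z.1 * C ≤ |C| := by
          calc D z.1 * C ≤ D z.1 * |C| := mul_le_mul_of_nonneg_left (le_abs_self C) h0
            _ ≤ 1 * |C| := mul_le_mul_of_nonneg_right h1 (abs_nonneg C)
            _ = |C| := one_mul _
        have hS : D z.1 * (2 * siteSource z.2 z.1 x) ≤
            ∑ y ∈ nbrs x, 2 * (|z.2.coef x y| ^ q + D z.1 * |z.1 y| ^ spinExp q) := by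
          rw [siteSource, ← mul_assoc, Finset.mul_sum]
          refine Finset.sum_le_sum fun y _ => ?_
          have : D z.1 * |z.2.coef x y| ^ q ≤ 1 * |z.2.coef x y| ^ q :=
            mul_le_mul_of_nonneg_right h1 (by positivity)
          linarith
        rw [mul_add]
        linarith
    _ = ENNReal.ofReal |C| + ∑ y ∈ nbrs x, 2 *
          (∫⁻ z, ENNReal.ofReal (|z.2.coef x y| ^ q) ∂(jointLaw ν μ) +
            ∫⁻ z, ENNReal.ofReal (D z.1 * |z.1 y| ^ spinExp q) ∂(jointLaw ν μ)) := by
        rw [lintegral_add_left measurable_const, lintegral_const, measure_univ, mul_one,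
          lintegral_finsetSum _ fun y _ => (hmsum y).const_mul 2]
        congr 1
        refine Finset.sum_congr rfl fun y _ => ?_
        rw [lintegral_const_mul _ (hmsum y), lintegral_add_left (hmJ y)]
    _ ≤ _ := by
        gcongr with y hy
        exact lintegral_coef_le hμ ((mem_nbrs x y).1 hy)

/-- Uniform moment bounds for random Gibbs measures. -/
theorem exists_lintegral_spin_rpow_le (hχ : SingleSpinCondition q χ)
    (hν : (⨆ e : Edge d, ∫⁻ J, ENNReal.ofReal (|J e| ^ q) ∂ν) < ∞)
    (hμ : Measurable fun J => (μ J : Measure (Config d)))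
    (hG : ∀ᵐ J ∂ν, μ J ∈ gibbsMeasures χ J) :
    ∃ L : ℝ, ∀ x, ∫⁻ z, ENNReal.ofReal (|z.1 x| ^ spinExp q) ∂(jointLaw ν μ) ≤
      ENNReal.ofReal L := by
  have hP := isProbabilityMeasure_jointLaw (ν := ν) hμ
  obtain ⟨w₀, hw₀, hw⟩ := w.nbr_bound
  -- This is the value of `l` at which `le_of_mul_le_add_sum_nbrs` contracts.
  have hl : (0 : ℝ) < 4 * 3 ^ d * (1 + w₀) := by positivity
  obtain ⟨C, hC0, hC⟩ := hχ.exists_lintegral_localGibbs_singleton_le w hl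
  set l : ℝ := 4 * 3 ^ d * (1 + w₀)
  set K := ⨆ e : Edge d, ∫⁻ J, ENNReal.ofReal (|J e| ^ q) ∂ν with hK
  let B : ℝ := C + 3 ^ d * (2 * K.toReal)
  let a : ℝ → Site d → ℝ≥0∞ := fun ε x =>
    ∫⁻ z, ENNReal.ofReal (damping q w ε z.1 * |z.1 x| ^ spinExp q) ∂(jointLaw ν μ)
  have hm : ∀ ε x, Measurable fun z : Config d × Intensity q w =>
      ENNReal.ofReal (damping q w ε z.1 * |z.1 x| ^ spinExp q) := fun ε x =>
    (((measurable_damping q w ε).comp measurable_fst).mul (measurable_spin_rpow x)).ennreal_ofReal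
  have hfin : ∀ ε, 0 < ε → ∀ x, a ε x ≤ ENNReal.ofReal ((1 / ε) / w x) := by
    intro ε hε x
    simp only [a]
    rw [lintegral_jointLaw hμ (hm ε x)]
    calc _ ≤ ∫⁻ _, ENNReal.ofReal ((1 / ε) / w x) ∂ν := by
          refine lintegral_mono_ae ?_
          filter_upwards [hG] with J hJ
          calc _ ≤ ∫⁻ _, ENNReal.ofReal ((1 / ε) / w x) ∂(μ J : Measure (Config d)) := by
                refine lintegral_mono_ae ?_
                filter_upwards [ae_mem_temperedConfig hJ] with ξ hξ
                exact ENNReal.ofReal_le_ofReal (damping_mul_le hε hξ x)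
            _ = _ := by simp
      _ = _ := by simp
  -- The recursion is averaged over `J`, since only `ν`-moments of the couplings are bounded
  -- uniformly in the edge.
  have hrec : ∀ ε, 0 < ε → ∀ x, ENNReal.ofReal l * a ε x ≤
      ENNReal.ofReal C + ∑ y ∈ nbrs x, 2 * (K + a ε y) := by
    intro ε hε x
    have hsrc := lintegral_damped_source_le (ν := ν) (w := w) hμ (measurable_damping q w ε)
      (damping_nonneg ε) (damping_le_one hε.le) (C := C) x
    rw [abs_of_nonneg hC0] at hsrc
    refine le_trans ?_ hsrc
    simp only [a]
    have hmS : Measurable fun z : Config d × Intensity q w =>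
        ENNReal.ofReal (damping q w ε z.1 * (2 * siteSource z.2 z.1 x + C)) :=
      (((measurable_damping q w ε).comp measurable_fst).mul
        (((measurable_siteSource (fun e => (measurable_apply_edge e).comp measurable_snd)
          measurable_fst x).const_mul 2).add_const C)).ennreal_ofReal
    rw [lintegral_jointLaw hμ (hm ε x), lintegral_jointLaw hμ hmS,
      ← lintegral_const_mul' _ _ ENNReal.ofReal_ne_top]
    refine lintegral_mono_ae ?_
    filter_upwards [hG] with J hJ
    exact lintegral_damping_mul_le hχ hl (hC x J) hJ hε
  have hbound : ∀ ε, 0 < ε → ∀ x, a ε x ≤ ENNReal.ofReal (2 * B / l) := by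
    intro ε hε x
    have htop : ∀ x, a ε x ≠ ∞ := fun x => ne_top_of_le_ne_top ENNReal.ofReal_ne_top (hfin ε hε x)
    rw [← ENNReal.ofReal_toReal (htop x)]
    refine ENNReal.ofReal_le_ofReal ?_
    have hKn : 0 ≤ K.toReal := ENNReal.toReal_nonneg
    refine le_of_mul_le_add_sum_nbrs (w := w) (a := fun x => (a ε x).toReal) (M := 1 / ε) hw₀ hw
      (by positivity) (by positivity) le_rfl (fun x => ?_) (fun x => ?_) x
    · have hsumtop : ∀ y ∈ nbrs x, 2 * (K + a ε y) ≠ ∞ := fun y _ =>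
        ENNReal.mul_ne_top ENNReal.ofNat_ne_top (ENNReal.add_ne_top.2 ⟨hν.ne, htop y⟩)
      have h := ENNReal.toReal_mono (ENNReal.add_ne_top.2
        ⟨ENNReal.ofReal_ne_top, ENNReal.sum_ne_top.2 hsumtop⟩) (hrec ε hε x)
      rw [ENNReal.toReal_mul, ENNReal.toReal_ofReal hl.le,
        ENNReal.toReal_add ENNReal.ofReal_ne_top (ENNReal.sum_ne_top.2 hsumtop),
        ENNReal.toReal_ofReal hC0, ENNReal.toReal_sum hsumtop] at h
      have h2 : ∀ y, (2 * (K + a ε y)).toReal = 2 * K.toReal + 2 * (a ε y).toReal := fun y => by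
        rw [ENNReal.toReal_mul, ENNReal.toReal_add hν.ne (htop y), ENNReal.toReal_ofNat, mul_add]
      simp only [h2] at h
      rw [Finset.sum_add_distrib, Finset.sum_const, nsmul_eq_mul, ← Finset.mul_sum] at h
      have h3 : ((nbrs x).card : ℝ) * (2 * K.toReal) ≤ 3 ^ d * (2 * K.toReal) :=
        mul_le_mul_of_nonneg_right (card_nbrs_le x) (by positivity)
      simp only [B]
      linarith
    · exact ENNReal.toReal_le_of_le_ofReal (div_nonneg (by positivity) (w.pos x).le) (hfin ε hε x)
  refine ⟨2 * B / l, fun x => ?_⟩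
  -- The damping tends to 1 along `ε = 1 / (n + 1)`. No temperedness is needed for this: `toReal`
  -- sends an infinite sum to 0.
  have hlim : ∀ z : Config d × Intensity q w, Tendsto (fun n : ℕ =>
      ENNReal.ofReal (damping q w (1 / ((n : ℝ) + 1)) z.1 * |z.1 x| ^ spinExp q)) atTop
      (𝓝 (ENNReal.ofReal (|z.1 x| ^ spinExp q))) := by
    intro z
    refine ENNReal.tendsto_ofReal ?_
    have h := tendsto_one_div_add_atTop_nhds_zero_nat (𝕜 := ℝ)
    have h2 := (((h.mul_const (temperedSum q w z.1).toReal).const_add 1).pow 2).inv₀ (by simp)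
    have h3 := h2.mul_const (|z.1 x| ^ spinExp q)
    simp only [zero_mul, add_zero, one_pow, inv_one, one_mul] at h3
    simpa only [damping, one_div] using h3
  calc _ = ∫⁻ z, liminf (fun n : ℕ => ENNReal.ofReal
        (damping q w (1 / ((n : ℝ) + 1)) z.1 * |z.1 x| ^ spinExp q)) atTop ∂(jointLaw ν μ) :=
        lintegral_congr fun z => (hlim z).liminf_eq.symm
    _ ≤ liminf (fun n : ℕ => a (1 / ((n : ℝ) + 1)) x) atTop :=
        lintegral_liminf_le fun n => hm _ x
    _ ≤ liminf (fun _ : ℕ => ENNReal.ofReal (2 * B / l)) atTop :=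
        liminf_le_liminf (Eventually.of_forall fun n => hbound _ (by positivity) x)
    _ = _ := liminf_const _

theorem measurable_jointPressure (χ : Site d → ProbabilityMeasure ℝ) (Δ : Finset (Site d)) :
    Measurable fun z : Config d × Intensity q w => pressure χ Δ z.2 z.1 :=
  measurable_pressure χ (fun e => (measurable_apply_edge e).comp measurable_snd) measurable_fst

/-- The local pressures are bounded in `L¹`, uniformly in the volume. -/
theorem exists_lintegral_pressure_le (hχ : SingleSpinCondition q χ)
    (hν : (⨆ e : Edge d, ∫⁻ J, ENNReal.ofReal (|J e| ^ q) ∂ν) < ∞)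
    (hμ : Measurable fun J => (μ J : Measure (Config d)))
    (hG : ∀ᵐ J ∂ν, μ J ∈ gibbsMeasures χ J) :
    ∃ B : ℝ≥0∞, B ≠ ∞ ∧ ∀ Δ : Finset (Site d), Δ.Nonempty →
      ∫⁻ z, ENNReal.ofReal |pressure χ Δ z.2 z.1| ∂(jointLaw ν μ) ≤ B := by
  obtain ⟨L, hL⟩ := exists_lintegral_spin_rpow_le hχ hν hμ hG
  obtain ⟨C, hC⟩ := hχ.exists_abs_pressure_le w
  set K := ⨆ e : Edge d, ∫⁻ J, ENNReal.ofReal (|J e| ^ q) ∂ν with hK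
  let B : ℝ≥0∞ := ENNReal.ofReal |C| + (3 ^ d : ℕ) * (2 * (K + ENNReal.ofReal L))
  have hsite : ∀ x, ∫⁻ z, ENNReal.ofReal (siteSource z.2 z.1 x + C) ∂(jointLaw ν μ) ≤ B := by
    intro x
    have hsrc := lintegral_damped_source_le (ν := ν) (w := w) hμ (D := fun _ => 1)
      measurable_const (fun _ => zero_le_one) (fun _ => le_rfl) (C := C) x
    refine le_trans (lintegral_mono fun z => ?_) (hsrc.trans ?_)
    · refine ENNReal.ofReal_le_ofReal ?_
      have := siteSource_nonneg z.2 z.1 x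
      linarith
    · refine add_le_add le_rfl ?_
      simp only [one_mul]
      calc _ ≤ ∑ y ∈ nbrs x, 2 * (K + ENNReal.ofReal L) := by
            gcongr with y hy
            exact hL y
        _ ≤ _ := by
            rw [Finset.sum_const, nsmul_eq_mul]
            gcongr
            exact_mod_cast card_nbrs_le x
  refine ⟨B, ?_, fun Δ hΔ => ?_⟩
  · exact ENNReal.add_ne_top.2 ⟨ENNReal.ofReal_ne_top, ENNReal.mul_ne_top (ENNReal.natCast_ne_top _)
      (ENNReal.mul_ne_top ENNReal.ofNat_ne_top (ENNReal.add_ne_top.2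
        ⟨hν.ne, ENNReal.ofReal_ne_top⟩))⟩
  have hms : ∀ x, Measurable fun z : Config d × Intensity q w =>
      ENNReal.ofReal (siteSource z.2 z.1 x + C) := fun x =>
    ((measurable_siteSource (fun e => (measurable_apply_edge e).comp measurable_snd)
      measurable_fst x).add_const C).ennreal_ofReal
  have hcard : (0 : ℝ) < Δ.card := by exact_mod_cast hΔ.card_pos
  calc _ ≤ ∫⁻ z, ENNReal.ofReal (1 / (Δ.card : ℝ)) *
        ∑ x ∈ Δ, ENNReal.ofReal (siteSource z.2 z.1 x + C) ∂(jointLaw ν μ) := by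
        refine lintegral_mono fun z => ?_
        refine (ENNReal.ofReal_le_ofReal (hC Δ hΔ z.2 z.1)).trans ?_
        rw [ENNReal.ofReal_mul (by positivity)]
        gcongr
        refine Finset.le_sum_of_subadditive _ ENNReal.ofReal_zero.le (fun _ _ => ENNReal.ofReal_add_le) _ _
    _ = ENNReal.ofReal (1 / (Δ.card : ℝ)) *
        ∑ x ∈ Δ, ∫⁻ z, ENNReal.ofReal (siteSource z.2 z.1 x + C) ∂(jointLaw ν μ) := by
        rw [lintegral_const_mul' _ _ ENNReal.ofReal_ne_top, lintegral_finsetSum _ fun x _ => hms x]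
    _ ≤ ENNReal.ofReal (1 / (Δ.card : ℝ)) * ∑ x ∈ Δ, B := by
        gcongr with x _
        exact hsite x
    _ = B := by
        rw [Finset.sum_const, nsmul_eq_mul, ← mul_assoc, ← ENNReal.ofReal_natCast Δ.card,
          ← ENNReal.ofReal_mul (by positivity), one_div_mul_cancel hcard.ne', ENNReal.ofReal_one,
          one_mul]

end JointLaw

/-! ### Cofinal sequences of cubes. -/

section Boxes

variable {d : ℕ}

/-- The cube `[-n, n]^d`. -/
def box (d n : ℕ) : Finset (Site d) := Finset.Icc (fun _ => -(n : ℤ)) fun _ => (n : ℤ)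

theorem isCofinal_box (hd : 0 < d) : IsCofinal (box d) where
  nonempty n := ⟨0, Finset.mem_Icc.2 ⟨fun _ => by simp, fun _ => by simp⟩⟩
  strictMono := strictMono_nat_of_lt_succ fun n => by
    refine Finset.ssubset_iff_subset_ne.2 ⟨Finset.Icc_subset_Icc (fun _ => by simp) fun _ => by simp,
      fun h => ?_⟩
    have h1 : (fun _ => ((n + 1 : ℕ) : ℤ)) ∈ box d (n + 1) :=
      Finset.mem_Icc.2 ⟨fun _ => by dsimp only; omega, le_rfl⟩
    rw [← h, box, Finset.mem_Icc] at h1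
    have h2 := h1.2 ⟨0, hd⟩
    dsimp only at h2
    omega
  exhausting x := by
    refine ⟨∑ i, (x i).natAbs, Finset.mem_Icc.2 ⟨fun i => ?_, fun i => ?_⟩⟩ <;>
    · have := Finset.single_le_sum (f := fun i => (x i).natAbs) (fun _ _ => Nat.zero_le _)
        (Finset.mem_univ i)
      dsimp only at this ⊢
      omega

theorem IsCofinal.comp_strictMono {D : ℕ → Finset (Site d)} (hD : IsCofinal D) {φ : ℕ → ℕ}
    (hφ : StrictMono φ) : IsCofinal (D ∘ φ) where
  nonempty n := hD.nonempty _
  strictMono := hD.strictMono.comp hφ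
  exhausting x := by
    obtain ⟨n, hn⟩ := hD.exhausting x
    exact ⟨n, hD.strictMono.monotone (hφ.le_apply) hn⟩

end Boxes

end RandomSpin

end
-- Convergence of the averaged pressures.
open RandomSpin in
theorem theorem5 (d : ℕ) (hd : 0 < d) (q : ℝ) [Fact (1 < q)] (w : Weight d)
    (χ : Site d → ProbabilityMeasure ℝ) (hχ : SingleSpinCondition q χ)
    -- any σ-field containing the Borel σ-field, such as the Borel one or its completion
    [MeasurableSpace (Intensity q w)] [OpensMeasurableSpace (Intensity q w)]
    (ν : Measure (Intensity q w)) [IsProbabilityMeasure ν]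
    (hν : (⨆ e : Edge d, ∫⁻ J, ENNReal.ofReal (|J e| ^ q) ∂ν) < ∞)
    (μ : Intensity q w → ProbabilityMeasure (Config d)) (hμ : IsRandomGibbsMeasure χ ν μ) :
    -- the integrals that define the μ-mean pressures converge
    (∀ᵐ J ∂ν, ∀ Δ : Finset (Site d), Δ.Nonempty →
      Integrable (fun ξ => pressure χ Δ J ξ) (μ J : Measure (Config d))) ∧
    (∃ D : ℕ → Finset (Site d), IsCofinal D ∧
      ∃ pμ : Intensity q w → ℝ, Integrable pμ ν ∧
        ∀ᵐ J ∂ν, Tendsto (fun N => meanAvgPressure χ μ D N J) atTop (𝓝 (pμ J))) ∧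
    (∃ D : ℕ → Finset (Site d), IsCofinal D ∧
      ∃ p : Config d × Intensity q w → ℝ, Integrable p (jointLaw ν μ) ∧
        ∀ᵐ z ∂(jointLaw ν μ),
          Tendsto (fun N => avgPressure χ D N z.2 z.1) atTop (𝓝 (p z))) := by
  have hμm := measurable_toMeasure_of_measurable_borel hμ.measurable
  have hP := isProbabilityMeasure_jointLaw (ν := ν) hμm
  obtain ⟨B, hB, hle⟩ := exists_lintegral_pressure_le hχ hν hμm hμ.ae_mem
  have hms := fun Δ => measurable_jointPressure (q := q) (w := w) χ Δ
  have hmabs : ∀ Δ, Measurable fun z : Config d × Intensity q w =>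
      ENNReal.ofReal |pressure χ Δ z.2 z.1| := fun Δ => (hms Δ).abs.ennreal_ofReal
  have hle' : ∀ Δ : Finset (Site d), Δ.Nonempty →
      ∫⁻ J, ∫⁻ ξ, ENNReal.ofReal |pressure χ Δ J ξ| ∂(μ J : Measure (Config d)) ∂ν ≤ B := by
    intro Δ hΔ
    have := hle Δ hΔ
    rwa [lintegral_jointLaw hμm (hmabs Δ)] at this
  have hint : ∀ᵐ J ∂ν, ∀ Δ : Finset (Site d), Δ.Nonempty →
      Integrable (fun ξ => pressure χ Δ J ξ) (μ J : Measure (Config d)) := by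
    -- There are countably many finite volumes, so one null set serves them all.
    refine ae_all_iff.2 fun Δ => ?_
    by_cases hΔ : Δ.Nonempty
    · filter_upwards [ae_lt_top (measurable_lintegral_gibbs hμm (hmabs Δ))
        (ne_top_of_le_ne_top hB (hle' Δ hΔ))] with J hJ _
      exact (integrable_and_integral_abs_le_of_lintegral_le
        ((hms Δ).comp measurable_prodMk_right).aestronglyMeasurable hJ.ne le_rfl).1
    · exact Eventually.of_forall fun J h => absurd h hΔ
  have hbox := isCofinal_box hd
  refine ⟨hint, ?_, ?_⟩
  -- Integrating out `ξ` does not increase the `L¹` norm, so the mean pressures inherit the bound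
  -- `B`.
  · let F : ℕ → Intensity q w → ℝ := fun n J =>
      ∫ ξ, pressure χ (box d n) J ξ ∂(μ J : Measure (Config d))
    have hF : ∀ n, Integrable (F n) ν ∧ ∫ J, |F n J| ∂ν ≤ B.toReal := by
      intro n
      refine integrable_and_integral_abs_le_of_lintegral_le ?_ hB
        (le_trans (lintegral_mono fun J => ?_) (hle' (box d n) (hbox.nonempty n)))
      · exact (StronglyMeasurable.integral_kernel_prod_right' (κ := gibbsKernel hμm)
          ((hms (box d n)).comp measurable_swap).stronglyMeasurable).aestronglyMeasurable
      · have := enorm_integral_le_lintegral_enorm (μ := (μ J : Measure (Config d)))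
          fun ξ => pressure χ (box d n) J ξ
        simpa only [← ofReal_norm, Real.norm_eq_abs] using this
    obtain ⟨φ, hφ, g, hg, hlim⟩ := exists_strictMono_cesaro_tendsto (fun n => (hF n).1)
      fun n => (hF n).2
    refine ⟨box d ∘ φ, hbox.comp_strictMono hφ, g, hg, ?_⟩
    filter_upwards [hlim, hint] with J hJ hi
    refine hJ.congr fun N => ?_
    simp only [meanAvgPressure, avgPressure, F, Function.comp_apply]
    rw [integral_const_mul, integral_finsetSum _ fun n _ => hi _ (hbox.nonempty _), one_div]
  · have hF := fun n => integrable_and_integral_abs_le_of_lintegral_le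
      (hms (box d n)).aestronglyMeasurable hB (hle (box d n) (hbox.nonempty n))
    obtain ⟨φ, hφ, g, hg, hlim⟩ := exists_strictMono_cesaro_tendsto (fun n => (hF n).1)
      fun n => (hF n).2
    refine ⟨box d ∘ φ, hbox.comp_strictMono hφ, g, hg, ?_⟩
    filter_upwards [hlim] with z hz
    simpa only [avgPressure, Function.comp_apply, one_div] using hz
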